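/- Proposition (First level CLT). For $N\ge 1$, $q>0$ and integers $\nu_1\ge\ldots\ge\nu_N$, let $P^N_{q,\nu}$ be the probability measure on the finite set of integer arrays $\boldsymbol\lambda=\{\lambda^k_j\in\mathbb Z: 1\le j\le k\le N\}$ with top row $\lambda^N_j=\nu_j$, $1\le j\le N$, satisfying the interlacing constraints $\lambda^k_j\le\lambda^{k-1}_{j-1}\le\lambda^k_{j-1}$ for $2\le j\le k\le N$, defined by $$P^N_{q,\nu}(\boldsymbol\lambda)=\frac{q^{\mathrm{vol}(\boldsymbol\lambda)}}{Z^N_{q,\nu}},\qquad \mathrm{vol}(\boldsymbol\lambda)=\sum_{k=1}^{N-1}\sum_{j=1}^{k}\lambda^k_j,$$ where $Z^N_{q,\nu}$ is the normalization constant. Fix $\gamma>0$ and a weakly decreasing, nonconstant, piecewise continuous function $f:[0,1]\to\mathbb R$. For each $N$ let $\nu=\nu(N)=(\nu_1\ge\ldots\ge\nu_N)$ be integers such that the functions $f_N(x)=\nu_{\lceil Nx\rceil}/N$, $x\in[0,1]$ (with the convention $\nu_0:=\nu_1$ at $x=0$), satisfy $$\sup_{x\in[0,1]}|f_N(x)-f(x)|=o(N^{-1/2}),\qquad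 N\to+\infty .$$ Let $q=q(N)=e^{-\gamma/N}$, and define $$u=\frac1\gamma\log\left(\frac{\int_0^1e^{\gamma s}\,ds}{\int_0^1e^{\gamma(s-f(s))}\,ds}\right),\qquad \sigma^2=\frac{1}{(e^\gamma-1)^2}\int_0^1\left(e^{2\gamma(u+s-f(s))}-e^{2\gamma s}\right)ds .$$ Then $\sigma^2>0$, and under $P^N_{q(N),\nu(N)}$ the single first-level entry $\lambda^1_1=\lambda^1_1(N)$ satisfies $$\frac{\lambda^1_1-uN}{\sqrt N}\to \mathsf N(0,\sigma^2)\qquad\text{in distribution as }N\to+\infty .$$ -/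

import Mathlib

open Set Filter Topology MeasureTheory ProbabilityTheory Asymptotics

/-- Interlacing integer arrays `λ^k_j`, `1 ≤ j ≤ k ≤ N`, of depth `N` whose top row `λ^N` is
`(ν 1, …, ν N)`. The entry `λ^k_j` is `entry k j` (indices start at `1`); outside of the triangle
`1 ≤ j ≤ k ≤ N` the function `entry` is set to `0`, so that it carries no further information. -/
@[ext]
structure InterlacingArray (N : ℕ) (ν : ℕ → ℤ) where
  entry : ℕ → ℕ → ℤ
  /-- `λ^k_j ≤ λ^{k-1}_{j-1} ≤ λ^k_{j-1}` for `2 ≤ j ≤ k ≤ N`. -/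
  interlacing : ∀ k j, 2 ≤ j → j ≤ k → k ≤ N →
    entry k j ≤ entry (k - 1) (j - 1) ∧ entry (k - 1) (j - 1) ≤ entry k (j - 1)
  top_row : ∀ j, 1 ≤ j → j ≤ N → entry N j = ν j
  entry_eq_zero : ∀ k j, ¬(1 ≤ j ∧ j ≤ k ∧ k ≤ N) → entry k j = 0

namespace InterlacingArray

variable {N : ℕ} {ν : ℕ → ℤ}

/-- The volume `|λ^1| + … + |λ^{N-1}|`, where `|λ^k| = λ^k_1 + … + λ^k_k`. -/
def vol (L : InterlacingArray N ν) : ℤ :=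
  ∑ k ∈ Finset.Ico 1 N, ∑ j ∈ Finset.Icc 1 k, L.entry k j

theorem entry_mem_Icc {a b : ℤ} (hab : ∀ j, 1 ≤ j → j ≤ N → a ≤ ν j ∧ ν j ≤ b)
    (L : InterlacingArray N ν) (d : ℕ) :
    ∀ k j, k + d = N → 1 ≤ j → j ≤ k → a ≤ L.entry k j ∧ L.entry k j ≤ b := by
  induction d with
  | zero =>
    intro k j hk h1 h2
    have hk' : k = N := by omega
    subst hk'
    rw [L.top_row j h1 h2]
    exact hab j h1 h2
  | succ d ih =>
    intro k j hk h1 h2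
    have h := L.interlacing (k + 1) (j + 1) (by omega) (by omega) (by omega)
    simp only [Nat.add_sub_cancel] at h
    exact ⟨(ih (k + 1) (j + 1) (by omega) (by omega) (by omega)).1.trans h.1,
      h.2.trans (ih (k + 1) j (by omega) h1 (by omega)).2⟩

instance : Finite (InterlacingArray N ν) := by
  obtain ⟨B, hB⟩ : ∃ B : ℤ, ∀ j, 1 ≤ j → j ≤ N → -B ≤ ν j ∧ ν j ≤ B := by
    refine ⟨∑ i ∈ Finset.Icc 1 N, |ν i|, fun j h1 h2 => abs_le.mp ?_⟩
    exact Finset.single_le_sum (f := fun i => |ν i|) (fun i _ => abs_nonneg _)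
      (Finset.mem_Icc.mpr ⟨h1, h2⟩)
  have key : ∀ (L : InterlacingArray N ν) (k j : ℕ), L.entry k j ∈ Set.Icc (min (-B) 0) (max B 0) := by
    intro L k j
    by_cases h : 1 ≤ j ∧ j ≤ k ∧ k ≤ N
    · have := L.entry_mem_Icc hB (N - k) k j (by omega) h.1 h.2.1
      exact ⟨(min_le_left _ _).trans this.1, this.2.trans (le_max_left _ _)⟩
    · rw [L.entry_eq_zero k j h]
      exact ⟨min_le_right _ _, le_max_right _ _⟩
  refine Finite.of_injective
    (β := Fin (N + 1) → Fin (N + 1) → Set.Icc (min (-B) 0) (max B 0))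
    (fun L k j => ⟨L.entry k j, key L k j⟩) ?_
  intro L M h
  ext k j
  by_cases hkj : 1 ≤ j ∧ j ≤ k ∧ k ≤ N
  · have := congrFun (congrFun h ⟨k, by omega⟩) ⟨j, by omega⟩
    simpa using this
  · rw [L.entry_eq_zero k j hkj, M.entry_eq_zero k j hkj]

noncomputable instance : Fintype (InterlacingArray N ν) := Fintype.ofFinite _

instance : MeasurableSpace (InterlacingArray N ν) := ⊤

theorem nonempty (hν : AntitoneOn ν (Set.Icc 1 N)) : Nonempty (InterlacingArray N ν) := by
  refine ⟨⟨fun k j => if 1 ≤ j ∧ j ≤ k ∧ k ≤ N then ν j else 0, ?_, ?_, ?_⟩⟩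
  · intro k j h2 hjk hkN
    rw [if_pos (by omega), if_pos (by omega), if_pos (by omega)]
    exact ⟨hν ⟨by omega, by omega⟩ ⟨by omega, by omega⟩ (by omega), le_rfl⟩
  · intro j h1 h2
    rw [if_pos (by omega)]
  · intro k j h
    rw [if_neg h]

/-- The normalization constant `Z = ∑_λ q^{vol λ}`. -/
noncomputable def partitionFunction (N : ℕ) (ν : ℕ → ℤ) (q : ℝ) : ℝ :=
  ∑ L : InterlacingArray N ν, q ^ L.vol

/-- The probability distribution `P(λ) = q^{vol λ} / Z` on the finite set of interlacing arrays of
depth `N` with top row `ν`, where `ν 1 ≥ … ≥ ν N` and `q > 0`. -/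
noncomputable def qVol (N : ℕ) (ν : ℕ → ℤ) (hν : AntitoneOn ν (Set.Icc 1 N)) (q : ℝ) (hq : 0 < q) :
    PMF (InterlacingArray N ν) :=
  PMF.ofFintype (fun L => ENNReal.ofReal (q ^ L.vol / partitionFunction N ν q)) (by
    have := nonempty hν
    have hZ : 0 < partitionFunction N ν q :=
      Finset.sum_pos (fun L _ => zpow_pos hq _) Finset.univ_nonempty
    rw [← ENNReal.ofReal_sum_of_nonneg (fun L _ => (div_pos (zpow_pos hq _) hZ).le),
      ← Finset.sum_div]
    change ENNReal.ofReal (partitionFunction N ν q / partitionFunction N ν q) = 1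
    rw [div_self hZ.ne', ENNReal.ofReal_one])

end InterlacingArray

/-- The rescaled top row `f_N(x) = ν_{⌈N x⌉} / N` for `x ∈ [0, 1]`, with the convention `ν_0 = ν_1`
for the value at `x = 0`. -/
noncomputable def rescaledRow (N : ℕ) (ν : ℕ → ℤ) (x : ℝ) : ℝ :=
  (ν (max 1 ⌈(N : ℝ) * x⌉₊) : ℝ) / N

/-- Piecewise continuity on `[a, b]`: continuity off a finite set of points, at which the one-sided
limits from within `[a, b]` exist and are finite. -/
def PiecewiseContinuousOn (f : ℝ → ℝ) (a b : ℝ) : Prop :=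
  ∃ D : Finset ℝ, ContinuousOn f (Set.Icc a b \ D) ∧
    (∀ x ∈ D, x ∈ Set.Ioc a b → ∃ l, Tendsto f (𝓝[<] x) (𝓝 l)) ∧
    (∀ x ∈ D, x ∈ Set.Ico a b → ∃ l, Tendsto f (𝓝[>] x) (𝓝 l))

/-- The global location `u`. -/
noncomputable def globalLocation (γ : ℝ) (f : ℝ → ℝ) : ℝ :=
  1 / γ * Real.log ((∫ s in (0 : ℝ)..1, Real.exp (γ * s)) /
    ∫ s in (0 : ℝ)..1, Real.exp (γ * (s - f s)))

/-- The limiting variance `σ²`. -/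
noncomputable def limitVariance (γ : ℝ) (f : ℝ → ℝ) : ℝ :=
  1 / (Real.exp γ - 1) ^ 2 *
    ∫ s in (0 : ℝ)..1,
      (Real.exp (2 * γ * (globalLocation γ f + s - f s)) - Real.exp (2 * s * γ))

/-! The entry $\lambda^1_1$ is reached through an exact identity in law. Let $e_j$ be independent
standard exponentials, independent of the array. Then $q^{\lambda^1_1}\sum_{k<N}q^k e_k$ has the law
of $\sum_j q^{\nu_j+N-j}e_j$. Taking logarithms, $\lambda^1_1\log q$ plus an independent variable,
the logarithm of the sum for the zero row, has the law of the logarithm of the sum for $\nu$. Both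
logarithms obey an explicit central limit theorem, so the characteristic function of $\lambda^1_1$
is a quotient of two functions with Gaussian limits. The variance $\sigma^2$ is the difference of
the two limiting variances, divided by $\gamma^2$.

The identity in law is an identity of characteristic functions: the expectation of
$\prod_{k<N}(1-zq^{\lambda^1_1+k})^{-1}$ is $\prod_j(1-zq^{\nu_j+N-j})^{-1}$ at $z=i\theta$. Summing
over arrays one row at a time turns a determinant into a larger one
(`Matrix.det_eq_sum_piFinset_Ico`, `exists_mul_sum_eq_det`), because the functions involved have
discrete derivatives of the same shape. The final determinant is a Vandermonde with one resolvent
row, evaluated in `det_resolvent_row`; `map_zpow_mul_weightedSum` draws the probabilistic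
conclusion.

The analytic half is `tendsto_integral_cexp_log_weightedSum`, which linearizes the logarithm at the
mean, together with Riemann sum estimates. The rate $o(N^{-1/2})$ is what makes the bias of the mean
vanish at the scale of the fluctuations. Positivity of $\sigma^2$ is a strict correlation inequality
for monotone functions, `integral_sq_mul_sq_integral_lt`. -/

/-! ### Determinants and branching of interlacing arrays -/

/-- Expansion of a determinant whose last row is constant over interlacing integer points. -/
theorem Matrix.det_eq_sum_piFinset_Ico {R : Type*} [CommRing R] {n : ℕ} (l : Fin (n + 2) → ℤ)
    (hl : ∀ j : Fin (n + 1), l j.succ ≤ l j.castSucc)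
    (P : Fin (n + 2) → ℤ → R) (p : Fin (n + 1) → ℤ → R)
    (hP : ∀ i m, P i.castSucc (m + 1) - P i.castSucc m = p i m)
    (hlast : ∀ m, P (Fin.last _) m = 1) :
    (Matrix.of fun i j => P i (l j)).det =
      ∑ m ∈ Fintype.piFinset (fun j : Fin (n + 1) => Finset.Ico (l j.succ) (l j.castSucc)),
        (Matrix.of fun i j => p i (m j)).det := by
  have htel : ∀ (i : Fin (n + 1)) (a b : ℤ), a ≤ b →
      P i.castSucc b - P i.castSucc a = ∑ m ∈ Finset.Ico a b, p i m := by
    intro i a b hab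
    induction b, hab using Int.leInduction with
    | base => simp
    | succ b hb ih =>
      have : Finset.Ico a (b + 1) = insert b (Finset.Ico a b) := by
        ext x; simp only [Finset.mem_Ico, Finset.mem_insert]; omega
      rw [this, Finset.sum_insert (by simp), ← ih, ← hP i b]
      ring
  -- Subtracting from each column its predecessor turns the constant last row into $(1,0,\dots,0)$.
  -- Expansion along that row leaves increments of the $P_i$ between consecutive points.
  have h1 : (Matrix.of fun i j => P i (l j)).det =
      (Matrix.of fun (i j : Fin (n + 2)) =>
        Fin.cases (P i (l 0)) (fun k => P i (l k.succ) - P i (l k.castSucc)) j).det := by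
    refine Matrix.det_eq_of_forall_col_eq_smul_add_pred (fun _ => 1) ?_ ?_
    · intro i; simp
    · intro i j; simp
  have h2 : (Matrix.of fun (i j : Fin (n + 2)) =>
        Fin.cases (P i (l 0)) (fun k => P i (l k.succ) - P i (l k.castSucc)) j).det =
      (-1) ^ (n + 1) * (Matrix.of fun i j : Fin (n + 1) =>
        P i.castSucc (l j.succ) - P i.castSucc (l j.castSucc)).det := by
    rw [Matrix.det_succ_row _ (Fin.last _), Fin.sum_univ_succ, Finset.sum_eq_zero]
    · simp only [Matrix.of_apply, Fin.cases_zero, hlast, Fin.val_last, Fin.val_zero, add_zero,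
        mul_one]
      congr 2
      ext i j
      simp [Fin.succAbove_last]
    · intro k _
      simp [hlast]
  -- The points decrease, so each increment is minus a sum of $p_i$; these signs cancel the cofactor
  -- sign $(-1)^{n+1}$.
  have h3 : (Matrix.of fun i j : Fin (n + 1) =>
        P i.castSucc (l j.succ) - P i.castSucc (l j.castSucc)) =
      - (Matrix.of fun j i : Fin (n + 1) =>
        ∑ m ∈ Finset.Ico (l j.succ) (l j.castSucc), p i m).transpose := by
    ext i j
    simp [← htel i _ _ (hl j)]
  rw [h1, h2, h3, Matrix.det_neg, Fintype.card_fin, ← mul_assoc, ← mul_pow, Matrix.det_transpose]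
  simp only [mul_neg, neg_neg, mul_one, one_pow, one_mul]
  have h4 := (Matrix.detRowAlternating (R := R) (n := Fin (n + 1))).toMultilinearMap.map_sum_finset
    (A := fun j : Fin (n + 1) => Finset.Ico (l j.succ) (l j.castSucc))
    (g := fun _ m i => p i m)
  have h5 : (Matrix.of fun j i : Fin (n + 1) =>
        ∑ m ∈ Finset.Ico (l j.succ) (l j.castSucc), p i m) =
      fun j => ∑ m ∈ Finset.Ico (l j.succ) (l j.castSucc), fun i => p i m := by
    ext j i
    simp
  rw [h5]
  refine h4.trans (Finset.sum_congr rfl fun m _ => ?_)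
  exact (Matrix.det_transpose _).symm

/-- The strictly decreasing sequence `ν_j + n + 1 - j` of a top row of length `n + 1`. -/
def strictRow (n : ℕ) (ν : ℕ → ℤ) (j : Fin (n + 1)) : ℤ := ν (j + 1) + n - j

/-- The row with given strictly decreasing sequence. -/
def ofStrictRow (n : ℕ) (m : Fin (n + 1) → ℤ) (k : ℕ) : ℤ :=
  if h : k - 1 < n + 1 then m ⟨k - 1, h⟩ + (k - 1 : ℕ) - n else 0

theorem strictRow_ofStrictRow (n : ℕ) (m : Fin (n + 1) → ℤ) :
    strictRow n (ofStrictRow n m) = m := by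
  ext j
  simp [strictRow, ofStrictRow, Nat.lt_succ_iff.mp j.isLt]

theorem ofStrictRow_strictRow (n : ℕ) (ν : ℕ → ℤ) (k : ℕ) (h1 : 1 ≤ k) (h2 : k ≤ n + 1) :
    ofStrictRow n (strictRow n ν) k = ν k := by
  obtain ⟨k, rfl⟩ : ∃ i, k = i + 1 := ⟨k - 1, by omega⟩
  rw [ofStrictRow, dif_pos (by omega)]
  simp [strictRow]

namespace InterlacingArray

/-- Removal of the top row. -/
def dropTop {n : ℕ} {ν μ : ℕ → ℤ} (L : InterlacingArray (n + 1) ν)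
    (h : ∀ j, 1 ≤ j → j ≤ n → L.entry n j = μ j) : InterlacingArray n μ where
  entry k j := if k ≤ n then L.entry k j else 0
  interlacing k j h1 h2 h3 := by
    rw [if_pos (by omega), if_pos (by omega), if_pos (by omega)]
    exact L.interlacing k j h1 h2 (by omega)
  top_row j h1 h2 := by rw [if_pos le_rfl]; exact h j h1 h2
  entry_eq_zero k j hk := by
    split_ifs with hkn
    · exact L.entry_eq_zero k j (by omega)
    · rfl

/-- Addition of a top row. -/
def addTop {n : ℕ} {ν μ : ℕ → ℤ} (L : InterlacingArray n μ)
    (h : ∀ j, 1 ≤ j → j ≤ n → ν (j + 1) ≤ μ j ∧ μ j ≤ ν j) : InterlacingArray (n + 1) ν where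
  entry k j := if k = n + 1 then (if 1 ≤ j ∧ j ≤ n + 1 then ν j else 0) else L.entry k j
  interlacing k j h1 h2 h3 := by
    by_cases hk : k = n + 1
    · obtain ⟨j, rfl⟩ : ∃ i, j = i + 1 := ⟨j - 1, by omega⟩
      subst hk
      simp only [Nat.add_sub_cancel]
      rw [if_pos trivial, if_pos (by omega), if_neg (by omega), if_pos trivial, if_pos (by omega),
        L.top_row j (by omega) (by omega)]
      exact h j (by omega) (by omega)
    · rw [if_neg hk, if_neg (by omega), if_neg hk]
      exact L.interlacing k j h1 h2 (by omega)
  top_row j h1 h2 := by rw [if_pos rfl, if_pos ⟨h1, h2⟩]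
  entry_eq_zero k j hk := by
    split_ifs with h1 h2
    · omega
    · rfl
    · exact L.entry_eq_zero k j (by omega)

theorem vol_succ {n : ℕ} {ν μ : ℕ → ℤ} (hn : 1 ≤ n) (L : InterlacingArray (n + 1) ν)
    (M : InterlacingArray n μ) (h : ∀ k j, k ≤ n → L.entry k j = M.entry k j) :
    L.vol = M.vol + ∑ j ∈ Finset.Icc 1 n, μ j := by
  unfold vol
  rw [← Finset.insert_Ico_right_eq_Ico_add_one hn, Finset.sum_insert (by simp), add_comm]
  congr 1
  · refine Finset.sum_congr rfl fun k hk => Finset.sum_congr rfl fun j _ => h k j ?_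
    simp only [Finset.mem_Ico] at hk; omega
  · refine Finset.sum_congr rfl fun j hj => ?_
    simp only [Finset.mem_Icc] at hj
    rw [h n j le_rfl, M.top_row j hj.1 hj.2]

theorem strictRow_succ_le {n : ℕ} {ν : ℕ → ℤ} (hν : AntitoneOn ν (Set.Icc 1 (n + 2)))
    (j : Fin (n + 1)) : strictRow (n + 1) ν j.succ ≤ strictRow (n + 1) ν j.castSucc := by
  have := hν (a := j + 1) (b := j + 2) ⟨by omega, by omega⟩ ⟨by omega, by omega⟩ (by omega)
  simp only [strictRow, Fin.val_succ, Fin.val_castSucc]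
  push_cast
  linarith

theorem sum_ofStrictRow (n : ℕ) (m : Fin (n + 1) → ℤ) :
    ∑ j ∈ Finset.Icc 1 (n + 1), ofStrictRow n m j = ∑ j, (m j + j - n) := by
  rw [← Finset.Ico_add_one_right_eq_Icc, Finset.sum_Ico_eq_sum_range, Finset.sum_range]
  refine Finset.sum_congr rfl fun j _ => ?_
  have hj : (j : ℕ) ≤ n := by have := j.isLt; omega
  simp [ofStrictRow, hj]

/-- Branching of sums over interlacing arrays. -/
theorem sum_branching (q : ℂ) (hq : q ≠ 0) (g : ℤ → ℂ) (n : ℕ) (ν : ℕ → ℤ) :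
    ∑ L : InterlacingArray (n + 2) ν, q ^ L.vol * g (L.entry 1 1) =
      ∑ m ∈ Fintype.piFinset (fun j : Fin (n + 1) =>
          Finset.Ico (strictRow (n + 1) ν j.succ) (strictRow (n + 1) ν j.castSucc)),
        q ^ (∑ j, (m j + j - n)) *
          ∑ L : InterlacingArray (n + 1) (ofStrictRow n m), q ^ L.vol * g (L.entry 1 1) := by
  classical
  -- The fibres are over the row just below the top. In strictly decreasing coordinates weak
  -- interlacing becomes membership in half-open intervals, so these rows fill a box, as the
  -- determinant expansion requires.
  rw [← Finset.sum_fiberwise_of_maps_to (s := Finset.univ)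
    (g := fun L : InterlacingArray (n + 2) ν => strictRow n (L.entry (n + 1)))]
  · refine Finset.sum_congr rfl fun m hm => ?_
    rw [Fintype.mem_piFinset] at hm
    rw [Finset.mul_sum]
    have hent : ∀ L : InterlacingArray (n + 2) ν, strictRow n (L.entry (n + 1)) = m →
        ∀ j, 1 ≤ j → j ≤ n + 1 → L.entry (n + 1) j = ofStrictRow n m j := by
      rintro L rfl j h1 h2
      exact (ofStrictRow_strictRow n _ j h1 h2).symm
    have hint : ∀ j, 1 ≤ j → j ≤ n + 1 →
        ν (j + 1) ≤ ofStrictRow n m j ∧ ofStrictRow n m j ≤ ν j := by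
      intro j h1 h2
      obtain ⟨j, rfl⟩ : ∃ i, j = i + 1 := ⟨j - 1, by omega⟩
      have := Finset.mem_Ico.mp (hm ⟨j, by omega⟩)
      simp only [strictRow, Fin.val_succ, Fin.val_castSucc] at this
      rw [ofStrictRow, dif_pos (by omega)]
      simp only [Nat.add_sub_cancel]
      push_cast at this
      constructor <;> linarith [this.1, this.2]
    refine Finset.sum_bij' (fun L hL => L.dropTop (hent L (Finset.mem_filter.mp hL).2))
      (fun L _ => L.addTop hint) ?_ ?_ ?_ ?_ ?_
    · simp
    · intro L _
      simp only [Finset.mem_filter, Finset.mem_univ, true_and]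
      refine Eq.trans ?_ (strictRow_ofStrictRow n m)
      ext j
      simp only [strictRow]
      rw [show (L.addTop hint).entry (n + 1) (j + 1) = L.entry (n + 1) (j + 1) from
        if_neg (by omega), L.top_row _ (by omega) (by omega)]
    · intro L hL
      ext k j
      simp only [addTop, dropTop]
      by_cases hk : k = n + 1 + 1
      · rw [if_pos hk, hk]
        split_ifs with hj
        · rw [L.top_row j hj.1 hj.2]
        · rw [L.entry_eq_zero]; omega
      · rw [if_neg hk]
        split_ifs with hk'
        · rfl
        · rw [L.entry_eq_zero]; omega
    · intro L _
      ext k j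
      simp only [addTop, dropTop]
      split_ifs with h1 h2
      · omega
      · omega
      · rfl
      · rw [L.entry_eq_zero]; omega
    · intro L hL
      have hL' := hent L (Finset.mem_filter.mp hL).2
      rw [vol_succ (by omega) L (L.dropTop hL')
          (fun k j hk => by simp only [dropTop]; rw [if_pos hk]), sum_ofStrictRow,
        zpow_add₀ hq, show (L.dropTop hL').entry 1 1 = L.entry 1 1 by simp [dropTop]]
      ring
  · intro L _
    rw [Fintype.mem_piFinset]
    intro j
    have h := L.interlacing (n + 2) (j + 2) (by omega) (by omega) (by omega)
    have e1 := L.top_row (j + 2) (by omega) (by omega)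
    have e2 := L.top_row (j + 1) (by omega) (by omega)
    simp only [show n + 2 - 1 = n + 1 from rfl, show (j : ℕ) + 2 - 1 = j + 1 from rfl, e1, e2] at h
    simp only [Finset.mem_Ico, strictRow, Fin.val_succ, Fin.val_castSucc]
    push_cast
    constructor <;> linarith [h.1, h.2]

end InterlacingArray

/-! ### Generating function of the first-level entry -/

theorem zpow_sum₀ {ι : Type*} {q : ℂ} (hq : q ≠ 0) (s : Finset ι) (m : ι → ℤ) :
    q ^ (∑ i ∈ s, m i) = ∏ i ∈ s, q ^ m i := by
  classical
  induction s using Finset.induction with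
  | empty => simp
  | insert a s ha ih => rw [Finset.sum_insert ha, Finset.prod_insert ha, zpow_add₀ hq, ih]

/-- `∏_{k < p} (1 - z q^{m + k})⁻¹`. -/
noncomputable def qShiftInv (q z : ℂ) (p : ℕ) (m : ℤ) : ℂ :=
  ∏ k ∈ Finset.range p, (1 - z * q ^ (m + k))⁻¹

/-- Both products on the left arise from the one with $p+1$ factors by cancelling an end factor. The
prefactor $q^m$ is the volume weight of one entry, and raising $p$ by one keeps the family closed
under differences. -/
theorem qShiftInv_add_one_sub {q z : ℂ} (hq : q ≠ 0) (hz : ∀ m : ℤ, 1 - z * q ^ m ≠ 0) (p : ℕ)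
    (m : ℤ) : qShiftInv q z p (m + 1) - qShiftInv q z p m =
      q ^ m * ((-z * (1 - q ^ p)) * qShiftInv q z (p + 1) m) := by
  have h1 : qShiftInv q z p (m + 1) = (1 - z * q ^ m) * qShiftInv q z (p + 1) m := by
    have hm := hz m
    rw [qShiftInv, qShiftInv, Finset.prod_range_succ']
    simp only [Nat.cast_add, Nat.cast_one, Nat.cast_zero, add_zero]
    rw [mul_comm, mul_assoc, inv_mul_cancel₀ hm, mul_one]
    exact Finset.prod_congr rfl fun k _ => by rw [add_assoc, add_comm (1 : ℤ)]
  have h2 : qShiftInv q z p m = (1 - z * q ^ (m + p)) * qShiftInv q z (p + 1) m := by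
    have hm := hz (m + p)
    rw [qShiftInv, qShiftInv, Finset.prod_range_succ, mul_comm, mul_assoc, inv_mul_cancel₀ hm,
      mul_one]
  rw [h1, h2, zpow_add₀ hq, zpow_natCast]
  ring

/-- The row functions of the determinant attached to rows of length `n + 1`. -/
noncomputable def rowFun (q : ℂ) (n : ℕ) (φ : ℤ → ℂ) (i : Fin (n + 1)) (m : ℤ) : ℂ :=
  if i = 0 then φ m else (q ^ m) ^ (n - i : ℕ)

namespace InterlacingArray

/-- Induction on the number of rows, with $p$ free because each added row lowers it by one. Only the
independence of $K$ from $\nu$ matters: its value is later eliminated by comparison with the zero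
row. -/
theorem exists_mul_sum_eq_det {q z : ℂ} (hq : q ≠ 0) (hz : ∀ m : ℤ, 1 - z * q ^ m ≠ 0)
    (n : ℕ) : ∀ p : ℕ, ∃ K : ℂ, ∀ ν : ℕ → ℤ, AntitoneOn ν (Set.Icc 1 (n + 1)) →
      K * ∑ L : InterlacingArray (n + 1) ν, q ^ L.vol * qShiftInv q z (p + n) (L.entry 1 1) =
        (Matrix.of fun i j => rowFun q n (qShiftInv q z p) i (strictRow n ν j)).det := by
  induction n with
  | zero =>
    intro p
    refine ⟨1, fun ν hν => ?_⟩
    have := nonempty hν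
    have : Subsingleton (InterlacingArray (0 + 1) ν) := ⟨fun L M => by
      ext k j
      by_cases h : 1 ≤ j ∧ j ≤ k ∧ k ≤ 0 + 1
      · obtain rfl : k = 0 + 1 := by omega
        rw [L.top_row j (by omega) (by omega), M.top_row j (by omega) (by omega)]
      · rw [L.entry_eq_zero _ _ h, M.entry_eq_zero _ _ h]⟩
    obtain ⟨L⟩ := ‹Nonempty (InterlacingArray (0 + 1) ν)›
    rw [Fintype.sum_subsingleton _ L]
    have := L.top_row 1 le_rfl le_rfl
    simp only [zero_add] at this
    simp [vol, rowFun, strictRow, this]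
  | succ n ih =>
    intro p
    obtain ⟨K, hK⟩ := ih (p + 1)
    -- The scalars produced by the discrete derivatives of the rows: the first comes from
    -- `qShiftInv_add_one_sub`, the others from differences of powers of $q^m$.
    let c : Fin (n + 1) → ℂ := fun i =>
      if i = 0 then -z * (1 - q ^ p) else q ^ (n + 1 - i : ℕ) - 1
    -- The power of $q$ corrects for the shift: the columns supply $q^{m_j}$, while the volume
    -- counts $m_j+j-n$.
    refine ⟨(∏ i, c i) * q ^ (∑ j : Fin (n + 1), ((n : ℤ) - j)) * K, fun ν hν => ?_⟩
    rw [Matrix.det_eq_sum_piFinset_Ico (strictRow (n + 1) ν) (strictRow_succ_le hν)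
      (rowFun q (n + 1) (qShiftInv q z p))
      (fun i m => q ^ m * (c i * rowFun q n (qShiftInv q z (p + 1)) i m)) ?_ ?_,
      sum_branching q hq, Finset.mul_sum]
    · refine Finset.sum_congr rfl fun m hm => ?_
      have h1 : (Matrix.of fun i j : Fin (n + 1) =>
          q ^ m j * (c i * rowFun q n (qShiftInv q z (p + 1)) i (m j))).det =
          (∏ j, q ^ m j) * ((∏ i, c i) * (Matrix.of fun i j : Fin (n + 1) =>
            rowFun q n (qShiftInv q z (p + 1)) i (m j)).det) := by
        rw [← Matrix.det_mul_column, ← Matrix.det_mul_row]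
        rfl
      have hmono : AntitoneOn (ofStrictRow n m) (Set.Icc 1 (n + 1)) := by
        rw [Fintype.mem_piFinset] at hm
        refine antitoneOn_of_succ_le ordConnected_Icc fun k _ hk hk' => ?_
        obtain ⟨k, rfl⟩ : ∃ i, k = i + 1 := ⟨k - 1, by have := hk.1; omega⟩
        have hk2 : k + 1 < n + 1 := hk'.2
        have e1 := Finset.mem_Ico.mp (hm ⟨k, by omega⟩)
        have e2 := Finset.mem_Ico.mp (hm ⟨k + 1, hk2⟩)
        rw [Order.succ_eq_add_one, ofStrictRow, dif_pos (show k + 1 + 1 - 1 < n + 1 from hk2),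
          ofStrictRow, dif_pos (show k + 1 - 1 < n + 1 by omega)]
        simp only [strictRow, Fin.val_succ, Fin.val_castSucc, Nat.add_sub_cancel] at e1 e2 ⊢
        push_cast at e1 e2 ⊢
        linarith [e1.1, e2.2]
      have h2 := hK (ofStrictRow n m) hmono
      rw [strictRow_ofStrictRow] at h2
      rw [h1, ← h2, show p + (n + 1) = p + 1 + n by ring]
      have h3 : ∏ j, q ^ m j = q ^ (∑ j : Fin (n + 1), ((n : ℤ) - j)) *
          q ^ (∑ j, (m j + j - n)) := by
        rw [← zpow_add₀ hq, ← Finset.sum_add_distrib]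
        rw [Finset.sum_congr rfl fun j _ => show (n : ℤ) - (j : Fin (n + 1)) + (m j + j - n) = m j by
          ring]
        exact (zpow_sum₀ hq _ _).symm
      rw [h3]
      ring
    · intro i m
      by_cases hi : i = 0
      · subst hi
        simp [rowFun, c, qShiftInv_add_one_sub hq hz]
      · have hi' : i.castSucc ≠ 0 := by simpa using hi
        have := i.isLt
        simp only [rowFun, if_neg hi', if_neg hi, c, Fin.val_castSucc]
        rw [show n + 1 - (i : ℕ) = n - i + 1 by omega, zpow_add_one₀ hq, mul_pow, pow_succ (q ^ m)]
        ring
    · intro m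
      simp [rowFun]

/-- The resolvent row `(1 - z y_j)⁻¹` can be traded for `y_j ^ n`. -/
theorem det_resolvent_row (n : ℕ) (z : ℂ) (y : Fin (n + 1) → ℂ) (hy : ∀ j, 1 - z * y j ≠ 0) :
    (Matrix.of fun i j : Fin (n + 1) =>
        if i = 0 then (1 - z * y j)⁻¹ else y j ^ (n - i : ℕ)).det * ∏ j, (1 - z * y j) =
      z ^ n * (Matrix.of fun i j : Fin (n + 1) => y j ^ (n - i : ℕ)).det := by
  -- Left multiplication by `C` sends the monomial matrix to the resolvent matrix with column $j$
  -- scaled by $1-zy_j$: row $0$ becomes $1$, and row $i$ becomes $y_j^{n-i}-zy_j^{n-i+1}$.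
  let C : Matrix (Fin (n + 1)) (Fin (n + 1)) ℂ := Matrix.of fun i k =>
    if i = 0 then (if k = Fin.last n then 1 else 0)
    else (if k = i then 1 else 0) - z * (if (k : ℕ) + 1 = i then 1 else 0)
  have hC : C.det = z ^ n := by
    rw [Matrix.det_succ_row_zero, Finset.sum_eq_single (Fin.last n)]
    · have h : (C.submatrix Fin.succ (Fin.last n).succAbove).det = (-z) ^ n := by
        have hd : ∀ i j : Fin n, (C.submatrix Fin.succ (Fin.last n).succAbove) i j =
            (if (j : ℕ) = i + 1 then 1 else 0) - z * (if (j : ℕ) = i then 1 else 0) := by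
          intro i j
          simp only [C, Matrix.submatrix_apply, Matrix.of_apply, Fin.succAbove_last]
          rw [if_neg (Fin.succ_ne_zero i)]
          simp only [Fin.ext_iff, Fin.val_castSucc, Fin.val_succ, Nat.add_right_cancel_iff]
        rw [Matrix.det_of_isUpperTriangular]
        · rw [Finset.prod_congr rfl fun i _ => hd i i]
          simp
        · intro i j hij
          have hij' : (j : ℕ) < i := hij
          have h1 : ¬ (j : ℕ) = i + 1 := by omega
          have h2 : ¬ (j : ℕ) = i := by omega
          simp only [hd, h1, h2, if_false, mul_zero, sub_zero]
      rw [h]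
      simp only [C, Matrix.of_apply, if_true, Fin.val_last, mul_one]
      rw [← mul_pow]
      simp
    · intro k _ hk
      simp [C, hk]
    · simp
  rw [← hC, ← Matrix.det_mul, mul_comm, ← Matrix.det_mul_row]
  congr 1
  ext i j
  simp only [Matrix.of_apply, Matrix.mul_apply, C]
  by_cases hi : i = 0
  · simp [hi, hy j]
  · obtain ⟨i, rfl⟩ := Fin.exists_succ_eq.mpr hi
    have h1 : ∀ k : Fin (n + 1), ((k : ℕ) + 1 = i.succ) ↔ k = i.castSucc := by
      intro k; simp [Fin.ext_iff]
    simp only [if_neg hi, h1, sub_mul, Finset.sum_sub_distrib, mul_assoc, ← Finset.mul_sum, ite_mul,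
      one_mul, zero_mul, Finset.sum_ite_eq', Finset.mem_univ, if_true]
    have := i.isLt
    rw [Fin.val_castSucc, Fin.val_succ, show n - (i : ℕ) = n - (i + 1) + 1 by omega, pow_succ]
    ring

/-- The Vandermonde determinant of the points `q ^ (ν_j + n + 1 - j)`. -/
noncomputable def rowVandermonde (q : ℂ) (n : ℕ) (ν : ℕ → ℤ) : ℂ :=
  (Matrix.of fun i j : Fin (n + 1) => (q ^ strictRow n ν j) ^ (n - i : ℕ)).det

theorem rowVandermonde_ne_zero {q : ℂ} {n : ℕ} {ν : ℕ → ℤ}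
    (h : Function.Injective fun j => q ^ strictRow n ν j) : rowVandermonde q n ν ≠ 0 := by
  have h1 : (Matrix.of fun i j : Fin (n + 1) => (q ^ strictRow n ν j) ^ (n - i : ℕ)) =
      (Matrix.vandermonde fun j => q ^ strictRow n ν j).transpose.submatrix Fin.revPerm id := by
    ext i j
    simp only [Matrix.of_apply, Matrix.submatrix_apply, Matrix.transpose_apply,
      Matrix.vandermonde_apply, id, Fin.revPerm_apply, Fin.val_rev]
    congr 1
    omega
  rw [rowVandermonde, h1, Matrix.det_permute, Matrix.det_transpose]
  refine mul_ne_zero ?_ (Matrix.det_vandermonde_ne_zero_iff.mpr h)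
  rcases Int.units_eq_one_or (Equiv.Perm.sign (Fin.revPerm (n := n + 1))) with h | h <;> simp [h]

/-- With top row zero the only array is the zero array. This makes the zero row a reference case in
which the sum is explicit. -/
theorem sum_zero_row (q : ℂ) (g : ℤ → ℂ) (n : ℕ) :
    ∑ L : InterlacingArray n (fun _ => 0), q ^ L.vol * g (L.entry 1 1) = g 0 := by
  have h0 : ∀ (L : InterlacingArray n (fun _ => 0)) k j, L.entry k j = 0 := by
    intro L k j
    by_cases h : 1 ≤ j ∧ j ≤ k ∧ k ≤ n
    · have := L.entry_mem_Icc (a := 0) (b := 0) (by simp) (n - k) k j (by omega) h.1 h.2.1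
      omega
    · exact L.entry_eq_zero k j h
  have : Subsingleton (InterlacingArray n (fun _ => 0)) := ⟨fun L M => by
    ext k j; rw [h0 L, h0 M]⟩
  obtain ⟨L⟩ := nonempty (N := n) (ν := fun _ => 0) (fun _ _ _ _ _ => le_rfl)
  rw [Fintype.sum_subsingleton _ L]
  simp [vol, h0]

/-- The determinant formula with $p=1$, whose first row is a resolvent, is applied to $\nu$ and to
the zero row; the unknown constant `K` is eliminated between the two. -/
theorem rowVandermonde_mul_sum {q z : ℂ} (hq : q ≠ 0) (hz0 : z ≠ 0)
    (hz : ∀ m : ℤ, 1 - z * q ^ m ≠ 0) (n : ℕ) (ν : ℕ → ℤ)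
    (hν : AntitoneOn ν (Set.Icc 1 (n + 1))) :
    rowVandermonde q n (fun _ => 0) *
        ∑ L : InterlacingArray (n + 1) ν, q ^ L.vol * qShiftInv q z (n + 1) (L.entry 1 1) =
      rowVandermonde q n ν * ∏ j, (1 - z * q ^ strictRow n ν j)⁻¹ := by
  obtain ⟨K, hK⟩ := exists_mul_sum_eq_det hq hz n 1
  have key : ∀ ν : ℕ → ℤ, AntitoneOn ν (Set.Icc 1 (n + 1)) →
      K * (∑ L : InterlacingArray (n + 1) ν, q ^ L.vol * qShiftInv q z (n + 1) (L.entry 1 1)) *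
        ∏ j, (1 - z * q ^ strictRow n ν j) = z ^ n * rowVandermonde q n ν := by
    intro ν hν
    have h := hK ν hν
    rw [add_comm 1 n] at h
    rw [h, rowVandermonde,
      ← det_resolvent_row n z (fun j => q ^ strictRow n ν j) fun j => hz _]
    congr 2
    ext i j
    simp [rowFun, qShiftInv]
  have h0 := key (fun _ => 0) (fun _ _ _ _ _ => le_rfl)
  rw [sum_zero_row] at h0
  -- The shifted zero row read backwards is $0,1,\dots,n$, so the two products are inverse to each
  -- other.
  have h1 : qShiftInv q z (n + 1) 0 * ∏ j, (1 - z * q ^ strictRow n (fun _ => 0) j) = 1 := by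
    rw [qShiftInv, Finset.prod_range, ← Equiv.prod_comp Fin.revPerm fun j =>
      (1 - z * q ^ strictRow n (fun _ => 0) j), ← Finset.prod_mul_distrib]
    refine Finset.prod_eq_one fun j _ => ?_
    have : strictRow n (fun _ => 0) (Fin.revPerm j) = 0 + (j : ℕ) := by
      have := j.isLt
      simp only [strictRow, Fin.revPerm_apply, Fin.val_rev]
      omega
    rw [this, inv_mul_cancel₀ (hz _)]
  rw [mul_assoc, h1, mul_one] at h0
  have h2 := key ν hν
  have hP : ∏ j, (1 - z * q ^ strictRow n ν j) ≠ 0 := Finset.prod_ne_zero_iff.mpr fun j _ => hz _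
  have hzn : z ^ n ≠ 0 := pow_ne_zero _ hz0
  rw [h0] at h2
  rw [Finset.prod_inv_distrib, ← div_eq_mul_inv, eq_div_iff hP]
  refine mul_left_cancel₀ hzn ?_
  rw [← h2]
  ring

end InterlacingArray

/-! ### Weighted sums of independent exponential variables -/

instance : IsProbabilityMeasure (expMeasure 1) := isProbabilityMeasure_expMeasure one_pos

theorem measurable_gammaPDF_one_one : Measurable (gammaPDF 1 1) :=
  (measurable_gammaPDFReal 1 1).ennreal_ofReal

theorem integral_expMeasure_one {E : Type*} [NormedAddCommGroup E] [NormedSpace ℝ E] (f : ℝ → E) :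
    ∫ x, f x ∂(expMeasure 1) = ∫ x in Ioi (0 : ℝ), Real.exp (-x) • f x := by
  rw [expMeasure, gammaMeasure, integral_withDensity_eq_integral_toReal_smul
    measurable_gammaPDF_one_one (by simp [gammaPDF]), ← integral_Ici_eq_integral_Ioi,
    ← integral_indicator measurableSet_Ici]
  congr 1
  ext x
  by_cases hx : 0 ≤ x
  · rw [indicator_of_mem (by exact hx), gammaPDF_of_nonneg hx]
    simp [ENNReal.toReal_ofReal, (Real.exp_pos _).le]
  · rw [indicator_of_notMem (by exact hx), gammaPDF_of_neg (not_le.mp hx)]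
    simp

theorem integrable_expMeasure_one {E : Type*} [NormedAddCommGroup E] [NormedSpace ℝ E] {f : ℝ → E}
    (hf : IntegrableOn (fun x => Real.exp (-x) • f x) (Ioi 0)) :
    Integrable f (expMeasure 1) := by
  rw [expMeasure, gammaMeasure, integrable_withDensity_iff_integrable_smul'
    measurable_gammaPDF_one_one (by simp [gammaPDF])]
  rw [← integrableOn_Ici_iff_integrableOn_Ioi, ← integrable_indicator_iff measurableSet_Ici] at hf
  refine hf.congr (ae_of_all _ fun x => ?_)
  beta_reduce
  by_cases hx : 0 ≤ x
  · rw [indicator_of_mem (by exact hx), gammaPDF_of_nonneg hx]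
    simp [ENNReal.toReal_ofReal, (Real.exp_pos _).le]
  · rw [indicator_of_notMem (by exact hx), gammaPDF_of_neg (not_le.mp hx)]
    simp

theorem ae_expMeasure_one_pos : ∀ᵐ x ∂(expMeasure 1), 0 < x := by
  rw [expMeasure, gammaMeasure, ae_withDensity_iff measurable_gammaPDF_one_one]
  filter_upwards [compl_mem_ae_iff.mpr (measure_singleton (0 : ℝ))] with x hx h
  by_contra hneg
  exact h (gammaPDF_of_neg (lt_of_le_of_ne (not_lt.mp hneg) hx))

theorem integral_cexp_expMeasure_one (θ : ℝ) :
    ∫ x : ℝ, Complex.exp (Complex.I * θ * x) ∂(expMeasure 1) = (1 - Complex.I * θ)⁻¹ := by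
  have h : ∀ x : ℝ, Real.exp (-x) • Complex.exp (Complex.I * θ * x) =
      Complex.exp ((-1 + Complex.I * θ) * x) := by
    intro x
    rw [Complex.real_smul, Complex.ofReal_exp, ← Complex.exp_add]
    congr 1
    push_cast
    ring
  rw [integral_expMeasure_one]
  simp_rw [h]
  rw [integral_exp_mul_complex_Ioi (by simp), show (-1 + Complex.I * θ) = -(1 - Complex.I * θ) by ring,
    neg_div_neg_eq, Complex.ofReal_zero, mul_zero, Complex.exp_zero, one_div]

theorem integral_pow_expMeasure_one (k : ℕ) :
    Integrable (fun x : ℝ => x ^ k) (expMeasure 1) ∧ ∫ x, x ^ k ∂(expMeasure 1) = k.factorial := by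
  have h : ∀ x : ℝ, Real.exp (-x) • x ^ k = Real.exp (-x) * x ^ ((k + 1 : ℝ) - 1) := by
    intro x
    rw [add_sub_cancel_right, Real.rpow_natCast, smul_eq_mul]
  constructor
  · refine integrable_expMeasure_one ?_
    simp_rw [h]
    exact Real.GammaIntegral_convergent (by positivity)
  · rw [integral_expMeasure_one]
    simp_rw [h]
    rw [← Real.Gamma_eq_integral (by positivity), Real.Gamma_nat_eq_factorial]

theorem memLp_two_id_expMeasure_one : MemLp (fun x : ℝ => x) 2 (expMeasure 1) :=
  (memLp_two_iff_integrable_sq aestronglyMeasurable_id).mpr (integral_pow_expMeasure_one 2).1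

theorem variance_id_expMeasure_one : Var[fun x : ℝ => x; expMeasure 1] = 1 := by
  rw [variance_eq_sub memLp_two_id_expMeasure_one]
  have h1 := (integral_pow_expMeasure_one 1).2
  have h2 := (integral_pow_expMeasure_one 2).2
  simp only [pow_one, Nat.factorial] at h1 h2
  simp only [Pi.pow_apply, h1, h2]
  norm_num

/-- The law of `n` independent standard exponential variables. -/
noncomputable def expPi (n : ℕ) : Measure (Fin n → ℝ) := Measure.pi fun _ => expMeasure 1

instance (n : ℕ) : IsProbabilityMeasure (expPi n) := by unfold expPi; infer_instance

/-- A linear combination of coordinates. -/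
def weightedSum {n : ℕ} (c e : Fin n → ℝ) : ℝ := ∑ j, c j * e j

@[fun_prop]
theorem measurable_weightedSum {n : ℕ} (c : Fin n → ℝ) : Measurable (weightedSum c) := by
  unfold weightedSum
  fun_prop

theorem weightedSum_smul {n : ℕ} (a : ℝ) (c e : Fin n → ℝ) :
    weightedSum (fun j => a * c j) e = a * weightedSum c e := by
  simp only [weightedSum, Finset.mul_sum, mul_assoc]

theorem integral_cexp_weightedSum {n : ℕ} (c : Fin n → ℝ) (θ : ℝ) :
    ∫ e, Complex.exp (Complex.I * θ * weightedSum c e) ∂(expPi n) =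
      ∏ j, (1 - Complex.I * (θ * c j : ℝ))⁻¹ := by
  have h : ∀ e : Fin n → ℝ, Complex.exp (Complex.I * θ * weightedSum c e) =
      ∏ j, Complex.exp (Complex.I * (θ * c j : ℝ) * e j) := by
    intro e
    rw [← Complex.exp_sum, weightedSum]
    congr 1
    push_cast
    rw [Finset.mul_sum]
    exact Finset.sum_congr rfl fun j _ => by ring
  simp_rw [h]
  rw [expPi, integral_fintype_prod_eq_prod
    (f := fun j (x : ℝ) => Complex.exp (Complex.I * (θ * c j : ℝ) * x))]
  exact Finset.prod_congr rfl fun j _ => integral_cexp_expMeasure_one _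

theorem ae_expPi_pos (n : ℕ) : ∀ᵐ e ∂(expPi n), ∀ j, 0 < e j := by
  refine ae_all_iff.mpr fun j => ?_
  exact (measurePreserving_eval (fun _ : Fin n => expMeasure 1) j).quasiMeasurePreserving.ae
    ae_expMeasure_one_pos

theorem ae_weightedSum_pos {n : ℕ} (hn : 0 < n) {c : Fin n → ℝ} (hc : ∀ j, 0 < c j) :
    ∀ᵐ e ∂(expPi n), 0 < weightedSum c e := by
  have : NeZero n := ⟨hn.ne'⟩
  filter_upwards [ae_expPi_pos n] with e he
  exact Finset.sum_pos (fun j _ => mul_pos (hc j) (he j)) Finset.univ_nonempty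

theorem memLp_weightedSum {n : ℕ} (c : Fin n → ℝ) : MemLp (weightedSum c) 2 (expPi n) := by
  unfold weightedSum
  refine memLp_finsetSum _ fun j _ => MemLp.const_mul ?_ _
  exact memLp_two_id_expMeasure_one.comp_measurePreserving
    (measurePreserving_eval (fun _ : Fin n => expMeasure 1) j)

theorem integral_weightedSum {n : ℕ} (c : Fin n → ℝ) :
    ∫ e, weightedSum c e ∂(expPi n) = ∑ j, c j := by
  have h1 := integral_pow_expMeasure_one 1
  simp only [pow_one, Nat.factorial] at h1
  unfold weightedSum expPi
  rw [integral_finsetSum _ fun j _ => (integrable_eval h1.1).const_mul _]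
  refine Finset.sum_congr rfl fun j _ => ?_
  rw [integral_const_mul, integral_eval, h1.2]
  simp

theorem variance_weightedSum {n : ℕ} (c : Fin n → ℝ) :
    Var[weightedSum c; expPi n] = ∑ j, c j ^ 2 := by
  have h := variance_sum_pi (μ := fun _ : Fin n => expMeasure 1) (X := fun j x => c j * x)
    fun j => memLp_two_id_expMeasure_one.const_mul _
  have h1 : ∀ j, Var[fun x => c j * x; expMeasure 1] = c j ^ 2 := fun j => by
    rw [variance_const_mul (c j) (fun x => x), variance_id_expMeasure_one, mul_one]
  rw [← Finset.sum_congr rfl fun j _ => h1 j, ← h, expPi]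
  congr 1
  ext e
  simp [weightedSum]

/-- Variance plus squared bias; this controls the error of linearizing the logarithm. -/
theorem integral_sq_weightedSum_sub {n : ℕ} (c : Fin n → ℝ) (a : ℝ) :
    Integrable (fun e => (weightedSum c e - a) ^ 2) (expPi n) ∧
      ∫ e, (weightedSum c e - a) ^ 2 ∂(expPi n) = ∑ j, c j ^ 2 + (∑ j, c j - a) ^ 2 := by
  have hm : MemLp (fun e => weightedSum c e - a) 2 (expPi n) :=
    (memLp_weightedSum c).sub (memLp_const a)
  refine ⟨hm.integrable_sq, ?_⟩
  have h := variance_eq_sub hm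
  rw [variance_sub_const (memLp_weightedSum c).aestronglyMeasurable, variance_weightedSum,
    integral_sub ((memLp_weightedSum c).integrable one_le_two) (integrable_const a),
    integral_weightedSum] at h
  have ha : ∫ _ : Fin n → ℝ, a ∂(expPi n) = a := by
    rw [integral_const, probReal_univ, one_smul]
  rw [ha] at h
  exact (eq_add_of_sub_eq h.symm)

/-! ### Identity in law for the first-level entry -/

namespace InterlacingArray

instance (N : ℕ) (ν : ℕ → ℤ) : DiscreteMeasurableSpace (InterlacingArray N ν) :=
  ⟨fun _ => trivial⟩

theorem partitionFunction_pos {N : ℕ} {ν : ℕ → ℤ} (hν : AntitoneOn ν (Set.Icc 1 N)) {q : ℝ}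
    (hq : 0 < q) : 0 < partitionFunction N ν q := by
  have := nonempty hν
  exact Finset.sum_pos (fun L _ => zpow_pos hq _) Finset.univ_nonempty

theorem integral_qVol {N : ℕ} {ν : ℕ → ℤ} (hν : AntitoneOn ν (Set.Icc 1 N)) {q : ℝ}
    (hq : 0 < q) (g : InterlacingArray N ν → ℂ) :
    ∫ L, g L ∂(qVol N ν hν q hq).toMeasure =
      (partitionFunction N ν q : ℂ)⁻¹ * ∑ L, (q : ℂ) ^ L.vol * g L := by
  rw [PMF.integral_eq_sum, Finset.mul_sum]
  refine Finset.sum_congr rfl fun L _ => ?_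
  rw [qVol, PMF.ofFintype_apply, ENNReal.toReal_ofReal
    (div_nonneg (zpow_pos hq _).le (partitionFunction_pos hν hq).le), Complex.real_smul]
  push_cast
  ring

/-- The points `q ^ (ν_j + n + 1 - j)`. -/
noncomputable def rowPoint (q : ℝ) (n : ℕ) (ν : ℕ → ℤ) (j : Fin (n + 1)) : ℝ :=
  q ^ strictRow n ν j

theorem rowPoint_zero_rev (q : ℝ) (n : ℕ) (j : Fin (n + 1)) :
    rowPoint q n (fun _ => 0) (Fin.revPerm j) = q ^ (j : ℕ) := by
  have := j.isLt
  rw [rowPoint, ← zpow_natCast]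
  congr 1
  simp only [strictRow, Fin.revPerm_apply, Fin.val_rev]
  omega

theorem integral_cexp_zpow_mul_weightedSum {q : ℝ} (hq : 0 < q) (n : ℕ) (m : ℤ) (θ : ℝ) :
    ∫ e, Complex.exp (Complex.I * θ *
        (q ^ m * weightedSum (rowPoint q n fun _ => 0) e : ℝ)) ∂(expPi (n + 1)) =
      qShiftInv q (Complex.I * θ) (n + 1) m := by
  simp_rw [← weightedSum_smul]
  rw [integral_cexp_weightedSum, qShiftInv, Finset.prod_range, ← Equiv.prod_comp Fin.revPerm]
  refine Finset.prod_congr rfl fun j _ => ?_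
  rw [rowPoint_zero_rev, zpow_add₀ (by exact_mod_cast hq.ne')]
  push_cast
  rw [zpow_natCast]
  ring

theorem one_sub_I_mul_ofReal_ne_zero (x : ℝ) : (1 : ℂ) - Complex.I * x ≠ 0 := by
  intro h
  have := congrArg Complex.re h
  simp at this

theorem strictRow_zero_injective {q : ℝ} (hq : 0 < q) (hq1 : q ≠ 1) (n : ℕ) :
    Function.Injective fun j => (q : ℂ) ^ strictRow n (fun _ => 0) j := by
  intro i j h
  beta_reduce at h
  have h' : q ^ strictRow n (fun _ => 0) i = q ^ strictRow n (fun _ => 0) j := by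
    exact_mod_cast h
  have := zpow_right_injective₀ hq hq1 h'
  simp only [strictRow] at this
  exact Fin.ext (by omega)

/-- Under the `q`-volume measure, `q ^ λ^1_1` times an independent sum of exponentials with weights
`1, q, …, q^n` has the law of the sum of exponentials with weights `q ^ (ν_j + n + 1 - j)`. -/
theorem map_zpow_mul_weightedSum {q : ℝ} (hq : 0 < q) (hq1 : q ≠ 1) (n : ℕ) (ν : ℕ → ℤ)
    (hν : AntitoneOn ν (Set.Icc 1 (n + 1))) :
    ((qVol (n + 1) ν (by exact_mod_cast hν) q hq).toMeasure.prod (expPi (n + 1))).map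
        (fun p => q ^ p.1.entry 1 1 * weightedSum (rowPoint q n fun _ => 0) p.2) =
      (expPi (n + 1)).map (weightedSum (rowPoint q n ν)) := by
  set P := (qVol (n + 1) ν (by exact_mod_cast hν) q hq).toMeasure with hP
  set f : InterlacingArray (n + 1) ν × (Fin (n + 1) → ℝ) → ℝ :=
    fun p => q ^ p.1.entry 1 1 * weightedSum (rowPoint q n fun _ => 0) p.2 with hf
  have hfm : Measurable f := by
    refine Measurable.mul ?_ (by fun_prop)
    exact (Measurable.of_discrete (f := fun L : InterlacingArray (n + 1) ν =>
      q ^ L.entry 1 1)).comp measurable_fst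
  have : IsProbabilityMeasure ((P.prod (expPi (n + 1))).map f) :=
    Measure.isProbabilityMeasure_map hfm.aemeasurable
  have : IsProbabilityMeasure ((expPi (n + 1)).map (weightedSum (rowPoint q n ν))) :=
    Measure.isProbabilityMeasure_map (by fun_prop)
  have hcf1 : ∀ θ : ℝ, charFun ((P.prod (expPi (n + 1))).map f) θ =
      (partitionFunction (n + 1) ν q : ℂ)⁻¹ * ∑ L : InterlacingArray (n + 1) ν,
        (q : ℂ) ^ L.vol * qShiftInv q (Complex.I * θ) (n + 1) (L.entry 1 1) := by
    intro θ
    have hm : Measurable fun x : ℝ => Complex.exp (θ * x * Complex.I) := by fun_prop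
    rw [charFun_apply_real, integral_map hfm.aemeasurable hm.aestronglyMeasurable,
      integral_prod, hP, integral_qVol]
    · congr 1
      refine Finset.sum_congr rfl fun L _ => ?_
      rw [← integral_cexp_zpow_mul_weightedSum hq]
      congr 2
      ext e
      congr 1
      ring
    · refine Integrable.of_bound (hm.comp hfm).aestronglyMeasurable 1 (ae_of_all _ fun p => ?_)
      rw [← Complex.ofReal_mul, Complex.norm_exp_ofReal_mul_I]
  have hcf2 : ∀ θ : ℝ, charFun ((expPi (n + 1)).map (weightedSum (rowPoint q n ν))) θ =
      ∏ j, (1 - Complex.I * θ * (q : ℂ) ^ strictRow n ν j)⁻¹ := by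
    intro θ
    have hm : Measurable fun x : ℝ => Complex.exp (θ * x * Complex.I) := by fun_prop
    rw [charFun_apply_real, integral_map (by fun_prop) hm.aestronglyMeasurable]
    have : ∀ x : ℂ, (θ : ℂ) * x * Complex.I = Complex.I * θ * x := fun x => by ring
    simp_rw [this]
    rw [integral_cexp_weightedSum]
    refine Finset.prod_congr rfl fun j _ => ?_
    rw [rowPoint]
    push_cast
    ring
  have hqc : (q : ℂ) ≠ 0 := by exact_mod_cast hq.ne'
  have hV := rowVandermonde_ne_zero (strictRow_zero_injective hq hq1 n)
  -- The value $\theta=0$ is excluded because the determinant formula was divided by a power of $z$.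
  obtain ⟨C, hC⟩ : ∃ C : ℂ, ∀ θ : ℝ, θ ≠ 0 → charFun ((P.prod (expPi (n + 1))).map f) θ =
      C * charFun ((expPi (n + 1)).map (weightedSum (rowPoint q n ν))) θ := by
    refine ⟨(partitionFunction (n + 1) ν q : ℂ)⁻¹ *
      (rowVandermonde q n ν / rowVandermonde q n fun _ => 0), fun θ hθ => ?_⟩
    have h := rowVandermonde_mul_sum hqc (z := Complex.I * θ)
      (mul_ne_zero Complex.I_ne_zero (by exact_mod_cast hθ)) (fun m => by
        have := one_sub_I_mul_ofReal_ne_zero (θ * q ^ m)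
        push_cast at this
        rwa [← mul_assoc] at this) n ν hν
    rw [hcf1, hcf2, mul_assoc]
    congr 1
    rw [div_mul_eq_mul_div, ← h, mul_div_cancel_left₀ _ hV]
  -- Continuity extends the proportionality to $\theta=0$, where both characteristic functions equal
  -- $1$. This forces $C=1$ without evaluating the partition function.
  have hall := Continuous.ext_on (dense_compl_singleton (0 : ℝ)) continuous_charFun
    (continuous_charFun.const_mul C) hC
  have hC1 : C = 1 := by
    have := congrFun hall 0
    simpa using this.symm
  refine Measure.ext_of_charFun ?_
  rw [hall, hC1]
  simp

/-- The logarithm turns the product in the identity in law into an independent sum, so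
characteristic functions multiply. Almost sure positivity of the weighted sum justifies splitting
the logarithm, and the free factor $a$ leaves room for normalization. -/
theorem integral_cexp_mul_integral_cexp {q : ℝ} (hq : 0 < q) (hq1 : q ≠ 1) (n : ℕ) (ν : ℕ → ℤ)
    (hν : AntitoneOn ν (Set.Icc 1 (n + 1))) (η a : ℝ) (ha : 0 < a) :
    (∫ L, Complex.exp (Complex.I * (η * (Real.log q * L.entry 1 1) : ℝ))
        ∂(qVol (n + 1) ν (by exact_mod_cast hν) q hq).toMeasure) *
      ∫ e, Complex.exp (Complex.I *
        (η * Real.log (a * weightedSum (rowPoint q n fun _ => 0) e) : ℝ)) ∂(expPi (n + 1)) =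
      ∫ e, Complex.exp (Complex.I * (η * Real.log (a * weightedSum (rowPoint q n ν) e) : ℝ))
        ∂(expPi (n + 1)) := by
  have hm : Measurable fun x : ℝ => Complex.exp (Complex.I * (η * Real.log (a * x) : ℝ)) := by
    fun_prop
  have hfm : Measurable fun p : InterlacingArray (n + 1) ν × (Fin (n + 1) → ℝ) =>
      q ^ p.1.entry 1 1 * weightedSum (rowPoint q n fun _ => 0) p.2 := by
    refine Measurable.mul ?_ (by fun_prop)
    exact (Measurable.of_discrete (f := fun L : InterlacingArray (n + 1) ν =>
      q ^ L.entry 1 1)).comp measurable_fst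
  have h1 := integral_map (μ := expPi (n + 1)) (measurable_weightedSum (rowPoint q n ν)).aemeasurable
    hm.aestronglyMeasurable
  rw [← h1, ← map_zpow_mul_weightedSum hq hq1 n ν hν,
    integral_map hfm.aemeasurable hm.aestronglyMeasurable, ← integral_prod_mul]
  refine integral_congr_ae ?_
  have hpos : ∀ᵐ e ∂(expPi (n + 1)), 0 < weightedSum (rowPoint q n fun _ => 0) e :=
    ae_weightedSum_pos n.succ_pos fun j => zpow_pos hq _
  filter_upwards [Measure.quasiMeasurePreserving_snd.ae hpos] with p hp
  rw [← Complex.exp_add, show a * (q ^ p.1.entry 1 1 * weightedSum (rowPoint q n fun _ => 0) p.2) =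
    q ^ p.1.entry 1 1 * (a * weightedSum (rowPoint q n fun _ => 0) p.2) by ring,
    Real.log_mul (zpow_pos hq _).ne' (mul_pos ha hp).ne', Real.log_zpow]
  congr 1
  push_cast
  ring

end InterlacingArray

/-! ### Central limit theorem for logarithms of weighted sums -/

theorem norm_prod_sub_prod_le_sum {ι : Type*} (s : Finset ι) (a b : ι → ℂ)
    (ha : ∀ i ∈ s, ‖a i‖ ≤ 1) (hb : ∀ i ∈ s, ‖b i‖ ≤ 1) :
    ‖∏ i ∈ s, a i - ∏ i ∈ s, b i‖ ≤ ∑ i ∈ s, ‖a i - b i‖ := by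
  classical
  induction s using Finset.induction with
  | empty => simp
  | insert x s hx ih =>
    rw [Finset.prod_insert hx, Finset.prod_insert hx, Finset.sum_insert hx]
    have ih' := ih (fun i hi => ha i (Finset.mem_insert_of_mem hi))
      (fun i hi => hb i (Finset.mem_insert_of_mem hi))
    have h1 : ‖∏ i ∈ s, a i‖ ≤ 1 := by
      rw [norm_prod]
      exact Finset.prod_le_one (fun _ _ => norm_nonneg _)
        fun i hi => ha i (Finset.mem_insert_of_mem hi)
    have h2 := hb x (Finset.mem_insert_self _ _)
    calc ‖a x * ∏ i ∈ s, a i - b x * ∏ i ∈ s, b i‖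
        = ‖(a x - b x) * ∏ i ∈ s, a i + b x * (∏ i ∈ s, a i - ∏ i ∈ s, b i)‖ := by
          congr 1; ring
      _ ≤ ‖a x - b x‖ * ‖∏ i ∈ s, a i‖ + ‖b x‖ * ‖∏ i ∈ s, a i - ∏ i ∈ s, b i‖ := by
          rw [← norm_mul, ← norm_mul]; exact norm_add_le _ _
      _ ≤ ‖a x - b x‖ * 1 + 1 * ∑ i ∈ s, ‖a i - b i‖ := by gcongr
      _ = _ := by ring

theorem norm_exp_sub_quadratic_le {w : ℂ} (hw : ‖w‖ ≤ 1) :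
    ‖Complex.exp w - (1 + w + w ^ 2 / 2)‖ ≤ ‖w‖ ^ 3 := by
  have h := Complex.exp_bound hw (n := 3) (by norm_num)
  have h3 : ∑ m ∈ Finset.range 3, w ^ m / (m.factorial : ℂ) = 1 + w + w ^ 2 / 2 := by
    simp [Finset.sum_range_succ, Nat.factorial]
  rw [h3] at h
  refine h.trans (mul_le_of_le_one_right (by positivity) ?_)
  norm_num [Nat.factorial]

theorem norm_inv_one_sub_I_mul_le (b : ℝ) : ‖(1 - Complex.I * b : ℂ)⁻¹‖ ≤ 1 := by
  rw [norm_inv]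
  refine inv_le_one_of_one_le₀ ?_
  have := Complex.abs_re_le_norm (1 - Complex.I * b)
  simpa using this

theorem norm_exp_I_mul_sub_sq_le (b : ℝ) :
    ‖Complex.exp (Complex.I * b - (b ^ 2 / 2 : ℝ))‖ ≤ 1 := by
  rw [Complex.norm_exp]
  refine Real.exp_le_one_iff.mpr ?_
  simp only [Complex.sub_re, Complex.mul_re, Complex.I_re, Complex.ofReal_re, Complex.I_im,
    Complex.ofReal_im]
  nlinarith [sq_nonneg b]

/-- The characteristic function of the centered exponential law agrees with the Gaussian one
to third order. -/
theorem norm_inv_one_sub_I_mul_sub_exp_le {b : ℝ} (hb : |b| ≤ 1 / 2) :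
    ‖(1 - Complex.I * b : ℂ)⁻¹ - Complex.exp (Complex.I * b - (b ^ 2 / 2 : ℝ))‖ ≤ 10 * |b| ^ 3 := by
  have hne := InterlacingArray.one_sub_I_mul_ofReal_ne_zero b
  have hI2 : Complex.I ^ 2 = -1 := Complex.I_sq
  have hb0 := abs_nonneg b
  set w : ℂ := Complex.I * b - (b ^ 2 / 2 : ℝ) with hw
  have hwn : ‖w‖ ≤ 2 * |b| := by
    calc ‖w‖ ≤ ‖Complex.I * b‖ + ‖((b ^ 2 / 2 : ℝ) : ℂ)‖ := norm_sub_le _ _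
      _ = |b| + |b| ^ 2 / 2 := by
        rw [norm_mul, Complex.norm_I, Complex.norm_real, Complex.norm_real, one_mul,
          Real.norm_eq_abs, Real.norm_eq_abs, abs_div, abs_pow, abs_two]
      _ ≤ 2 * |b| := by nlinarith
  -- Both functions expand as $1+ib-b^2$ up to cubic terms. The three remainders contribute $1$, $8$
  -- and $1$ to the constant $10$.
  have h1 : (1 - Complex.I * b : ℂ)⁻¹ - Complex.exp w =
      -((b : ℂ) ^ 3 * (Complex.I * (1 - Complex.I * b)⁻¹)) -
        (Complex.exp w - (1 + w + w ^ 2 / 2)) + (b : ℂ) ^ 3 * (Complex.I / 2 - b / 8) := by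
    have e1 : (1 - Complex.I * b : ℂ)⁻¹ =
        1 + Complex.I * b - b ^ 2 - (b : ℂ) ^ 3 * (Complex.I * (1 - Complex.I * b)⁻¹) := by
      field_simp
      linear_combination ((b : ℂ) ^ 2) * hI2
    have e2 : w + w ^ 2 / 2 =
        Complex.I * b - b ^ 2 - (b : ℂ) ^ 3 * (Complex.I / 2 - b / 8) := by
      rw [hw]; push_cast
      linear_combination ((b : ℂ) ^ 2 / 2) * hI2
    rw [show (1 : ℂ) + w + w ^ 2 / 2 = 1 + (w + w ^ 2 / 2) by ring, e2]
    nth_rewrite 1 [e1]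
    ring
  have hbn : ‖(b : ℂ)‖ = |b| := by rw [Complex.norm_real, Real.norm_eq_abs]
  rw [h1]
  have n1 : ‖-((b : ℂ) ^ 3 * (Complex.I * (1 - Complex.I * b)⁻¹))‖ ≤ |b| ^ 3 := by
    rw [norm_neg, norm_mul, norm_mul, Complex.norm_I, one_mul, norm_pow, hbn]
    exact mul_le_of_le_one_right (by positivity) (norm_inv_one_sub_I_mul_le b)
  have n2 : ‖Complex.exp w - (1 + w + w ^ 2 / 2)‖ ≤ 8 * |b| ^ 3 := by
    refine (norm_exp_sub_quadratic_le (by linarith)).trans ?_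
    calc ‖w‖ ^ 3 ≤ (2 * |b|) ^ 3 := by gcongr
      _ = 8 * |b| ^ 3 := by ring
  have n3 : ‖(b : ℂ) ^ 3 * (Complex.I / 2 - b / 8)‖ ≤ |b| ^ 3 := by
    rw [norm_mul, norm_pow, hbn]
    refine mul_le_of_le_one_right (by positivity) ((norm_sub_le _ _).trans ?_)
    rw [norm_div, norm_div, Complex.norm_I, hbn]
    norm_num
    linarith
  calc _ ≤ ‖-((b : ℂ) ^ 3 * (Complex.I * (1 - Complex.I * b)⁻¹))‖ +
        ‖Complex.exp w - (1 + w + w ^ 2 / 2)‖ + ‖(b : ℂ) ^ 3 * (Complex.I / 2 - b / 8)‖ :=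
        (norm_add_le _ _).trans (add_le_add_left (norm_sub_le _ _) _)
    _ ≤ _ := by linarith

theorem norm_exp_I_mul_sub_exp_I_mul_le (x y : ℝ) :
    ‖Complex.exp (Complex.I * x) - Complex.exp (Complex.I * y)‖ ≤ |x - y| := by
  have : Complex.exp (Complex.I * x) - Complex.exp (Complex.I * y) =
      Complex.exp (Complex.I * y) * (Complex.exp (Complex.I * (x - y : ℝ)) - 1) := by
    rw [mul_sub, ← Complex.exp_add, mul_one]
    congr 2
    push_cast; ring
  rw [this, norm_mul, Complex.norm_exp_I_mul_ofReal, one_mul]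
  exact Real.norm_exp_I_mul_ofReal_sub_one_le

/-- Linearization of the logarithm inside a bounded oscillating exponential. -/
theorem norm_exp_log_sub_exp_linear_le {t x : ℝ} :
    ‖Complex.exp (Complex.I * (t * Real.log x : ℝ)) - Complex.exp (Complex.I * (t * (x - 1) : ℝ))‖ ≤
      (2 * |t| + 8) * (x - 1) ^ 2 := by
  by_cases h : |x - 1| ≤ 1 / 2
  · refine (norm_exp_I_mul_sub_exp_I_mul_le _ _).trans ?_
    have h1 := Real.abs_log_sub_add_sum_range_le (x := 1 - x) (by rw [abs_sub_comm]; linarith) 1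
    simp only [Finset.sum_range_one, Nat.cast_zero, zero_add, pow_one, div_one, sub_sub_cancel] at h1
    rw [← mul_sub, abs_mul]
    have h2 : |Real.log x - (x - 1)| ≤ 2 * (x - 1) ^ 2 := by
      rw [show Real.log x - (x - 1) = 1 - x + Real.log x by ring]
      refine h1.trans ?_
      rw [abs_sub_comm, div_le_iff₀ (by linarith), show (1 + 1) = 2 from rfl, sq_abs]
      nlinarith [sq_nonneg (x - 1)]
    nlinarith [abs_nonneg t, sq_nonneg (x - 1)]
  -- Away from $1$ the trivial bound $2$ is at most $8(x-1)^2$; this also covers nonpositive $x$,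
  -- where the logarithm takes its conventional value.
  · have h1 : 1 / 4 ≤ (x - 1) ^ 2 := by
      rw [← sq_abs]; nlinarith [not_le.mp h]
    calc _ ≤ ‖Complex.exp (Complex.I * (t * Real.log x : ℝ))‖ +
          ‖Complex.exp (Complex.I * (t * (x - 1) : ℝ))‖ := norm_sub_le _ _
      _ = 2 := by rw [Complex.norm_exp_I_mul_ofReal, Complex.norm_exp_I_mul_ofReal]; norm_num
      _ ≤ _ := by nlinarith [abs_nonneg t]

/-- Independence gives a product of factors of modulus at most one, compared factor by factor; the
shift $a$ contributes only a phase. -/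
theorem norm_integral_linear_sub_gaussian_le {n : ℕ} (c : Fin n → ℝ) (t a B : ℝ)
    (hB : ∀ j, |t * c j| ≤ B) (hB2 : B ≤ 1 / 2) :
    ‖∫ e, Complex.exp (Complex.I * (t * weightedSum c e - a : ℝ)) ∂(expPi n) -
      Complex.exp (Complex.I * (t * ∑ j, c j - a : ℝ) - (t ^ 2 * (∑ j, c j ^ 2) / 2 : ℝ))‖ ≤
      n * (10 * B ^ 3) := by
  have h1 : ∫ e, Complex.exp (Complex.I * (t * weightedSum c e - a : ℝ)) ∂(expPi n) =
      Complex.exp (Complex.I * (-a : ℝ)) * ∏ j, (1 - Complex.I * (t * c j : ℝ))⁻¹ := by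
    rw [← integral_cexp_weightedSum, ← integral_const_mul]
    congr 1
    ext e
    rw [← Complex.exp_add]
    congr 1
    push_cast
    ring
  have h2 : Complex.exp (Complex.I * (t * ∑ j, c j - a : ℝ) - (t ^ 2 * (∑ j, c j ^ 2) / 2 : ℝ)) =
      Complex.exp (Complex.I * (-a : ℝ)) *
        ∏ j, Complex.exp (Complex.I * (t * c j : ℝ) - ((t * c j) ^ 2 / 2 : ℝ)) := by
    rw [← Complex.exp_sum, ← Complex.exp_add, Finset.sum_sub_distrib, ← Finset.mul_sum,
      ← Complex.ofReal_sum, ← Complex.ofReal_sum, ← Finset.mul_sum, ← Finset.sum_div]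
    simp_rw [mul_pow]
    rw [← Finset.mul_sum]
    congr 1
    push_cast
    ring
  rw [h1, h2, ← mul_sub, norm_mul, Complex.norm_exp_I_mul_ofReal, one_mul]
  refine (norm_prod_sub_prod_le_sum _ _ _ (fun j _ => norm_inv_one_sub_I_mul_le _)
    fun j _ => norm_exp_I_mul_sub_sq_le _).trans ?_
  calc ∑ j : Fin n, ‖(1 - Complex.I * (t * c j : ℝ) : ℂ)⁻¹ -
        Complex.exp (Complex.I * (t * c j : ℝ) - ((t * c j) ^ 2 / 2 : ℝ))‖
      ≤ ∑ _j : Fin n, 10 * B ^ 3 := by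
        refine Finset.sum_le_sum fun j _ =>
          (norm_inv_one_sub_I_mul_sub_exp_le ((hB j).trans hB2)).trans ?_
        have := hB j
        gcongr
    _ = _ := by simp

theorem norm_integral_log_sub_linear_le {n : ℕ} (c : Fin n → ℝ) (t s : ℝ) :
    ‖∫ e, Complex.exp (Complex.I * (t * Real.log (s * weightedSum c e) : ℝ)) ∂(expPi n) -
      ∫ e, Complex.exp (Complex.I * (t * (s * weightedSum c e - 1) : ℝ)) ∂(expPi n)‖ ≤
      (2 * |t| + 8) * (s ^ 2 * ∑ j, c j ^ 2 + (s * ∑ j, c j - 1) ^ 2) := by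
  have hint : ∀ g : ℝ → ℝ, Measurable g → Integrable
      (fun e => Complex.exp (Complex.I * (g (weightedSum c e) : ℝ))) (expPi n) := by
    intro g hg
    refine Integrable.of_bound (Measurable.aestronglyMeasurable (by fun_prop)) 1
      (ae_of_all _ fun e => ?_)
    rw [Complex.norm_exp_I_mul_ofReal]
  rw [← integral_sub (hint (fun x => t * Real.log (s * x)) (by fun_prop))
    (hint (fun x => t * (s * x - 1)) (by fun_prop))]
  obtain ⟨h1, h2⟩ := integral_sq_weightedSum_sub (fun j => s * c j) 1
  simp only [weightedSum_smul, mul_pow, ← Finset.mul_sum] at h1 h2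
  rw [← h2, ← integral_const_mul]
  exact norm_integral_le_of_norm_le (h1.const_mul _)
    (ae_of_all _ fun e => norm_exp_log_sub_exp_linear_le)

/-- Central limit theorem for the logarithm of a weighted average of exponential variables. -/
theorem tendsto_integral_cexp_log_weightedSum (c : (n : ℕ) → Fin n → ℝ) {B m v : ℝ} (hm : 0 < m)
    (hc : ∀ᶠ n in atTop, ∀ j, |c n j| ≤ B)
    (h1 : Tendsto (fun n : ℕ => √n * ((∑ j, c n j) / n - m)) atTop (𝓝 0))
    (h2 : Tendsto (fun n : ℕ => (∑ j, c n j ^ 2) / n) atTop (𝓝 v)) (κ : ℝ) :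
    Tendsto (fun n : ℕ => ∫ e, Complex.exp (Complex.I *
        (κ * √n * Real.log ((n * m)⁻¹ * weightedSum (c n) e) : ℝ)) ∂(expPi n))
      atTop (𝓝 (Complex.exp (-(κ ^ 2 * (v / m ^ 2) / 2) : ℝ))) := by
  have hsqrt : Tendsto (fun n : ℕ => √(n : ℝ)) atTop atTop :=
    Real.tendsto_sqrt_atTop.comp tendsto_natCast_atTop_atTop
  have hinv : Tendsto (fun n : ℕ => (√(n : ℝ))⁻¹) atTop (𝓝 0) := hsqrt.inv_tendsto_atTop
  set A : ℕ → ℂ := fun n => ∫ e, Complex.exp (Complex.I *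
        (κ * √n * Real.log ((n * m)⁻¹ * weightedSum (c n) e) : ℝ)) ∂(expPi n)
  set J : ℕ → ℂ := fun n => ∫ e, Complex.exp (Complex.I *
        (κ * √n * ((n * m)⁻¹ * weightedSum (c n) e - 1) : ℝ)) ∂(expPi n) with hJ
  set G : ℕ → ℂ := fun n => Complex.exp (Complex.I *
      (κ / m * (√n * ((∑ j, c n j) / n - m)) : ℝ) -
      (κ ^ 2 * ((∑ j, c n j ^ 2) / n / m ^ 2) / 2 : ℝ)) with hG
  have hpos : ∀ᶠ n : ℕ in atTop, (0 : ℝ) < n :=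
    (eventually_gt_atTop 0).mono fun n hn => by exact_mod_cast hn
  -- Linearization error: a frequency of order $\sqrt n$ times a second moment about $1$ that is
  -- $O(1/n)$ from the variance and $o(1/n)$ from the bias, by `h1`.
  have hAJ : Tendsto (fun n => A n - J n) atTop (𝓝 0) := by
    have hlim : Tendsto (fun n : ℕ => (2 * |κ| + 8 * (√(n : ℝ))⁻¹) *
        ((√(n : ℝ))⁻¹ * ((∑ j, c n j ^ 2) / n / m ^ 2) +
          (√(n : ℝ))⁻¹ * (√n * ((∑ j, c n j) / n - m)) ^ 2 / m ^ 2)) atTop (𝓝 0) := by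
      have := ((hinv.const_mul 8).const_add (2 * |κ|)).mul
        ((hinv.mul (h2.div_const (m ^ 2))).add ((hinv.mul (h1.pow 2)).div_const (m ^ 2)))
      simpa using this
    refine squeeze_zero_norm' ?_ hlim
    filter_upwards [hpos] with n hn
    refine (norm_integral_log_sub_linear_le (c n) (κ * √n) (n * m)⁻¹).trans (le_of_eq ?_)
    have hs : 0 < √(n : ℝ) := Real.sqrt_pos.mpr hn
    have hs2 : (n : ℝ) = √(n : ℝ) ^ 2 := (Real.sq_sqrt hn.le).symm
    rw [abs_mul, abs_of_pos hs]
    generalize √(n : ℝ) = r at *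
    rw [hs2]
    field_simp
  -- Gaussian error: $n$ factors, each off by $O(n^{-3/2})$ since the weights are bounded.
  have hJG : Tendsto (fun n => J n - G n) atTop (𝓝 0) := by
    have hlim : Tendsto (fun n : ℕ => 10 * (|κ| * |B| / m) ^ 3 * (√(n : ℝ))⁻¹) atTop (𝓝 0) := by
      simpa using hinv.const_mul (10 * (|κ| * |B| / m) ^ 3)
    have hsmall : ∀ᶠ n : ℕ in atTop, |κ| * |B| / m * (√(n : ℝ))⁻¹ < 1 / 2 := by
      have := hinv.const_mul (|κ| * |B| / m)
      rw [mul_zero] at this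
      exact this.eventually_lt_const (by norm_num)
    refine squeeze_zero_norm' ?_ hlim
    filter_upwards [hpos, hc, hsmall] with n hn hcn hsm
    have hs : 0 < √(n : ℝ) := Real.sqrt_pos.mpr hn
    have hs2 : (n : ℝ) = √(n : ℝ) ^ 2 := (Real.sq_sqrt hn.le).symm
    have key := norm_integral_linear_sub_gaussian_le (c n) (κ / (m * √n)) (κ * √n)
      (|κ| * |B| / m * (√(n : ℝ))⁻¹) (fun j => by
        rw [abs_mul, abs_div, abs_mul, abs_of_pos hm, abs_of_pos hs]
        calc |κ| / (m * √n) * |c n j| ≤ |κ| / (m * √n) * |B| :=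
              mul_le_mul_of_nonneg_left ((hcn j).trans (le_abs_self B)) (by positivity)
          _ = _ := by field_simp) hsm.le
    have e1 : J n = ∫ e, Complex.exp (Complex.I *
        (κ / (m * √n) * weightedSum (c n) e - κ * √n : ℝ)) ∂(expPi n) := by
      refine integral_congr_ae (ae_of_all _ fun e => ?_)
      have : κ * √n * ((n * m)⁻¹ * weightedSum (c n) e - 1) =
          κ / (m * √n) * weightedSum (c n) e - κ * √n := by
        generalize √(n : ℝ) = r at *
        rw [hs2]
        field_simp
      beta_reduce
      rw [this]
    have e2 : G n = Complex.exp (Complex.I * (κ / (m * √n) * ∑ j, c n j - κ * √n : ℝ) -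
        ((κ / (m * √n)) ^ 2 * (∑ j, c n j ^ 2) / 2 : ℝ)) := by
      have r1 : κ / m * (√n * ((∑ j, c n j) / n - m)) =
          κ / (m * √n) * ∑ j, c n j - κ * √n := by
        generalize √(n : ℝ) = r at *
        rw [hs2]
        field_simp
      have r2 : κ ^ 2 * ((∑ j, c n j ^ 2) / n / m ^ 2) / 2 =
          (κ / (m * √n)) ^ 2 * (∑ j, c n j ^ 2) / 2 := by
        generalize √(n : ℝ) = r at *
        rw [hs2]
        field_simp
      simp only [hG]
      rw [r1, r2]
    rw [e1, e2]
    refine key.trans (le_of_eq ?_)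
    generalize √(n : ℝ) = r at *
    rw [hs2]
    field_simp
  have hGlim : Tendsto G atTop (𝓝 (Complex.exp (-(κ ^ 2 * (v / m ^ 2) / 2) : ℝ))) := by
    have h3 := (Complex.continuous_ofReal.tendsto _).comp (h1.const_mul (κ / m))
    have h4 := (Complex.continuous_ofReal.tendsto _).comp
      (((h2.div_const (m ^ 2)).const_mul (κ ^ 2)).div_const 2)
    have h5 := (Complex.continuous_exp.tendsto _).comp ((h3.const_mul Complex.I).sub h4)
    simpa [Function.comp_def, hG] using h5
  have := (hAJ.add hJG).add hGlim
  simpa using this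

/-! ### Riemann sums of the rescaled top row -/

theorem rescaledRow_of_mem_Ioc {N k : ℕ} (hN : 0 < N) (ν : ℕ → ℤ) {x : ℝ}
    (hx : x ∈ Ioc ((k : ℝ) / N) ((k + 1 : ℕ) / N)) :
    rescaledRow N ν x = ν (k + 1) / N := by
  have hN' : (0 : ℝ) < N := by exact_mod_cast hN
  have h1 : (k : ℝ) < N * x := by
    have := hx.1; rw [div_lt_iff₀ hN'] at this; linarith
  have h2 : (N : ℝ) * x ≤ (k + 1 : ℕ) := by
    have := hx.2; rw [le_div_iff₀ hN'] at this; linarith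
  have : ⌈(N : ℝ) * x⌉₊ = k + 1 := by
    refine le_antisymm (Nat.ceil_le.mpr h2) (Nat.lt_ceil.mpr h1)
  rw [rescaledRow, this, max_eq_right (by omega)]

theorem AntitoneOn.abs_le_max {f : ℝ → ℝ} (hf : AntitoneOn f (Icc 0 1)) {x : ℝ}
    (hx : x ∈ Icc (0 : ℝ) 1) : |f x| ≤ max |f 0| |f 1| := by
  have h0 := hf (left_mem_Icc.mpr zero_le_one) hx hx.1
  have h1 := hf hx (right_mem_Icc.mpr zero_le_one) hx.2
  rw [max_comm]
  exact abs_le_max_abs_abs h1 h0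

theorem abs_rescaledRow_sub_le_iSup {f : ℝ → ℝ} (hf : AntitoneOn f (Icc 0 1)) (N : ℕ) (ν : ℕ → ℤ)
    {x : ℝ} (hx : x ∈ Icc (0 : ℝ) 1) :
    |rescaledRow N ν x - f x| ≤ ⨆ y : Icc (0 : ℝ) 1, |rescaledRow N ν y - f y| := by
  refine le_ciSup (f := fun y : Icc (0 : ℝ) 1 => |rescaledRow N ν y - f y|) ?_ ⟨x, hx⟩
  refine ⟨(∑ i ∈ Finset.range (N + 2), |(ν i : ℝ)|) / N + max |f 0| |f 1|, ?_⟩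
  rintro _ ⟨⟨y, hy⟩, rfl⟩
  refine (abs_sub _ _).trans (add_le_add ?_ (hf.abs_le_max hy))
  rw [rescaledRow, abs_div, Nat.abs_cast]
  refine div_le_div_of_nonneg_right ?_ (Nat.cast_nonneg N)
  refine Finset.single_le_sum (f := fun i => |(ν i : ℝ)|) (fun i _ => abs_nonneg _) ?_
  have : ⌈(N : ℝ) * y⌉₊ ≤ N :=
    Nat.ceil_le.mpr (mul_le_of_le_one_right (Nat.cast_nonneg N) hy.2)
  simp only [Finset.mem_range]
  omega

theorem abs_exp_sub_exp_le {a b M : ℝ} (ha : a ≤ M) (hb : b ≤ M) :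
    |Real.exp a - Real.exp b| ≤ Real.exp M * |a - b| := by
  wlog h : b ≤ a generalizing a b
  · rw [abs_sub_comm, abs_sub_comm a b]
    exact this hb ha (not_le.mp h).le
  rw [abs_of_nonneg (sub_nonneg.mpr (Real.exp_le_exp.mpr h)), abs_of_nonneg (sub_nonneg.mpr h)]
  have h1 : Real.exp b = Real.exp a * Real.exp (b - a) := by rw [← Real.exp_add]; ring_nf
  have h2 := Real.add_one_le_exp (b - a)
  have h3 := Real.exp_le_exp.mpr ha
  have h4 := Real.exp_pos a
  calc Real.exp a - Real.exp b = Real.exp a * (1 - Real.exp (b - a)) := by rw [h1]; ring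
    _ ≤ Real.exp a * (a - b) := mul_le_mul_of_nonneg_left (by linarith) h4.le
    _ ≤ Real.exp M * (a - b) := by gcongr

/-- The integrand is a continuous function times the monotone function $e^{-\alpha f}$. -/
theorem intervalIntegrable_exp_mul_sub {f : ℝ → ℝ} (hf : AntitoneOn f (Icc 0 1)) {α : ℝ}
    (hα : 0 ≤ α) : IntervalIntegrable (fun s => Real.exp (α * (s - f s))) volume 0 1 := by
  have h1 : MonotoneOn (fun s => Real.exp (-(α * f s))) (uIcc 0 1) := by
    rw [uIcc_of_le zero_le_one]
    intro x hx y hy hxy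
    exact Real.exp_le_exp.mpr (neg_le_neg (mul_le_mul_of_nonneg_left (hf hx hy hxy) hα))
  have h2 : ContinuousOn (fun s => Real.exp (α * s)) (uIcc 0 1) := by fun_prop
  refine (h1.intervalIntegrable.mul_continuousOn h2).congr ?_
  intro s _
  beta_reduce
  rw [← Real.exp_add]
  ring_nf

/-- The weights `exp (α ((j + 1) - ν_{j + 1}) / N)`. -/
noncomputable def expWeight (α : ℝ) (N : ℕ) (ν : ℕ → ℤ) (j : Fin N) : ℝ :=
  Real.exp (α * ((j + 1 : ℕ) / N - ν (j + 1) / N))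

theorem expWeight_le {f : ℝ → ℝ} (hf : AntitoneOn f (Icc 0 1)) {α : ℝ} (hα : 0 ≤ α) {N : ℕ}
    {ν : ℕ → ℤ} {D : ℝ} (hD : ∀ x ∈ Icc (0 : ℝ) 1, |rescaledRow N ν x - f x| ≤ D) (hD1 : D ≤ 1)
    (j : Fin N) : α * ((j + 1 : ℕ) / N - ν (j + 1) / N) ≤ α * (2 + max |f 0| |f 1|) := by
  have hN : 0 < N := j.pos
  have hN' : (0 : ℝ) < N := by exact_mod_cast hN
  have hj : ((j + 1 : ℕ) : ℝ) ≤ N := by exact_mod_cast j.isLt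
  have hx : ((j + 1 : ℕ) : ℝ) / N ∈ Icc (0 : ℝ) 1 := ⟨by positivity, (div_le_one hN').mpr hj⟩
  have h := hD _ hx
  rw [rescaledRow_of_mem_Ioc hN ν (k := j) ⟨by gcongr; omega, le_rfl⟩] at h
  have h2 := hf.abs_le_max hx
  have := abs_le.mp h
  have := abs_le.mp h2
  have := hx.2
  refine mul_le_mul_of_nonneg_left ?_ hα
  linarith

/-- On a cell of length $1/N$ the two exponents differ by at most $\alpha(1/N+D)$: one part from
moving $s$, the other from replacing $f$ by the rescaled row. Since $D\le 1$, both exponents stay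
below a bound independent of $N$. -/
theorem abs_sum_expWeight_sub_integral_le {f : ℝ → ℝ} (hf : AntitoneOn f (Icc 0 1)) {α : ℝ}
    (hα : 0 ≤ α) {N : ℕ} (hN : 0 < N) {ν : ℕ → ℤ} {D : ℝ}
    (hD : ∀ x ∈ Icc (0 : ℝ) 1, |rescaledRow N ν x - f x| ≤ D) (hD1 : D ≤ 1) :
    |(∑ j, expWeight α N ν j) / N - ∫ s in (0 : ℝ)..1, Real.exp (α * (s - f s))| ≤
      Real.exp (α * (2 + max |f 0| |f 1|)) * (α * (1 / N + D)) := by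
  have hN' : (0 : ℝ) < N := by exact_mod_cast hN
  set g : ℝ → ℝ := fun s => Real.exp (α * (s - f s)) with hg
  have hint := intervalIntegrable_exp_mul_sub hf hα
  have hsub : ∀ k < N, uIcc ((k : ℝ) / N) ((k + 1 : ℕ) / N) ⊆ uIcc 0 1 := by
    intro k hk
    rw [uIcc_of_le (by gcongr; omega), uIcc_of_le zero_le_one]
    refine Icc_subset_Icc (by positivity) ((div_le_one hN').mpr (by exact_mod_cast hk))
  have hadj := intervalIntegral.sum_integral_adjacent_intervals (μ := volume) (f := g)
    (a := fun k : ℕ => (k : ℝ) / N) (n := N) fun k hk => hint.mono_set (hsub k hk)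
  simp only [Nat.cast_zero, zero_div, div_self hN'.ne'] at hadj
  have hlen : ∀ k : ℕ, ((k + 1 : ℕ) : ℝ) / N - k / N = 1 / N := by
    intro k; push_cast; field_simp; ring
  rw [← hadj, Finset.sum_range, Finset.sum_div, ← Finset.sum_sub_distrib]
  have hterm : ∀ j : Fin N, |expWeight α N ν j / N -
      ∫ s in ((j : ℕ) : ℝ) / N..((j + 1 : ℕ) : ℝ) / N, g s| ≤
      Real.exp (α * (2 + max |f 0| |f 1|)) * (α * (1 / N + D)) * (1 / N) := by
    intro j
    have hle : ((j : ℕ) : ℝ) / N ≤ ((j + 1 : ℕ) : ℝ) / N := by gcongr; omega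
    have e : expWeight α N ν j / N =
        ∫ s in ((j : ℕ) : ℝ) / N..((j + 1 : ℕ) : ℝ) / N, expWeight α N ν j := by
      rw [intervalIntegral.integral_const, hlen, smul_eq_mul]; ring
    rw [e, ← intervalIntegral.integral_sub intervalIntegrable_const
      (hint.mono_set (hsub j j.isLt)), ← Real.norm_eq_abs]
    refine (intervalIntegral.norm_integral_le_of_norm_le_const (C :=
      Real.exp (α * (2 + max |f 0| |f 1|)) * (α * (1 / N + D))) fun s hs => ?_).trans ?_
    · rw [uIoc_of_le hle] at hs
      have hs1 : s ∈ Icc (0 : ℝ) 1 := by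
        have := hsub j j.isLt
        rw [uIcc_of_le hle, uIcc_of_le zero_le_one] at this
        exact this (Ioc_subset_Icc_self hs)
      have hDs := hD s hs1
      rw [rescaledRow_of_mem_Ioc hN ν hs] at hDs
      have hfs := abs_le.mp (hf.abs_le_max hs1)
      rw [Real.norm_eq_abs]
      refine (abs_exp_sub_exp_le (expWeight_le hf hα hD hD1 j)
        (mul_le_mul_of_nonneg_left (by linarith [hs1.2]) hα)).trans ?_
      refine mul_le_mul_of_nonneg_left ?_ (Real.exp_pos _).le
      rw [← mul_sub, abs_mul, abs_of_nonneg hα]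
      refine mul_le_mul_of_nonneg_left ?_ hα
      have h1 := hlen j
      rw [abs_le] at hDs ⊢
      constructor <;> linarith [hs.1, hs.2, hDs.1, hDs.2]
    · rw [hlen, abs_of_pos (show (0 : ℝ) < 1 / N by positivity)]
  calc _ ≤ ∑ j : Fin N, Real.exp (α * (2 + max |f 0| |f 1|)) * (α * (1 / N + D)) * (1 / N) :=
        (Finset.abs_sum_le_sum_abs _ _).trans (Finset.sum_le_sum fun j _ => hterm j)
    _ = _ := by
      rw [Finset.sum_const, Finset.card_univ, Fintype.card_fin, nsmul_eq_mul]
      field_simp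

theorem tendsto_sqrt_mul_sum_expWeight {f : ℝ → ℝ} (hf : AntitoneOn f (Icc 0 1)) {α : ℝ}
    (hα : 0 ≤ α) {ν : ℕ → ℕ → ℤ} {D : ℕ → ℝ}
    (hD : ∀ N, ∀ x ∈ Icc (0 : ℝ) 1, |rescaledRow N (ν N) x - f x| ≤ D N)
    (hD0 : Tendsto (fun N : ℕ => √N * D N) atTop (𝓝 0)) (hD1 : ∀ᶠ N in atTop, D N ≤ 1) :
    Tendsto (fun N : ℕ => √N * ((∑ j, expWeight α N (ν N) j) / N -
      ∫ s in (0 : ℝ)..1, Real.exp (α * (s - f s)))) atTop (𝓝 0) := by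
  have hinv : Tendsto (fun n : ℕ => (√(n : ℝ))⁻¹) atTop (𝓝 0) :=
    (Real.tendsto_sqrt_atTop.comp tendsto_natCast_atTop_atTop).inv_tendsto_atTop
  have hlim := ((hinv.add hD0).const_mul α).const_mul (Real.exp (α * (2 + max |f 0| |f 1|)))
  simp only [add_zero, mul_zero] at hlim
  refine squeeze_zero_norm' ?_ hlim
  filter_upwards [hD1, eventually_gt_atTop 0] with N hN1 hN
  have hN' : (0 : ℝ) < N := by exact_mod_cast hN
  have hs : 0 < √(N : ℝ) := Real.sqrt_pos.mpr hN'
  rw [Real.norm_eq_abs, abs_mul, abs_of_pos hs]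
  refine (mul_le_mul_of_nonneg_left
    (abs_sum_expWeight_sub_integral_le hf hα hN (hD N) hN1) hs.le).trans (le_of_eq ?_)
  have hs2 : √(N : ℝ) * (1 / N) = (√(N : ℝ))⁻¹ := by
    rw [mul_one_div, Real.sqrt_div_self', one_div]
  rw [← hs2]
  ring

theorem tendsto_of_tendsto_sqrt_mul_sub {x : ℕ → ℝ} {a : ℝ}
    (h : Tendsto (fun N : ℕ => √N * (x N - a)) atTop (𝓝 0)) : Tendsto x atTop (𝓝 a) := by
  have hinv : Tendsto (fun n : ℕ => (√(n : ℝ))⁻¹) atTop (𝓝 0) :=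
    (Real.tendsto_sqrt_atTop.comp tendsto_natCast_atTop_atTop).inv_tendsto_atTop
  have h1 := (hinv.mul h).add_const a
  rw [zero_mul, zero_add] at h1
  refine h1.congr' ?_
  filter_upwards [eventually_gt_atTop 0] with N hN
  have hs : √(N : ℝ) ≠ 0 := (Real.sqrt_pos.mpr (by exact_mod_cast hN)).ne'
  field_simp
  ring

/-! ### Formula and positivity of the limiting variance -/

/-- Strict Chebyshev-type inequality for a monotone function against a monotone weight. -/
theorem integral_sq_mul_sq_integral_lt {a b : ℝ → ℝ} (ha : MonotoneOn a (Icc 0 1))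
    (ha0 : ∀ s, 0 < a s) (hb : Monotone b) (hbc : Continuous b) (hb0 : ∀ s, 0 < b s)
    (hne : ∀ C, ¬ ∀ᵐ s : ℝ, s ∈ Ioc (0 : ℝ) 1 → a s = C) :
    (∫ s in (0 : ℝ)..1, b s ^ 2) * (∫ s in (0 : ℝ)..1, a s * b s) ^ 2 <
      (∫ s in (0 : ℝ)..1, (a s * b s) ^ 2) * (∫ s in (0 : ℝ)..1, b s) ^ 2 := by
  have hu : uIcc (0 : ℝ) 1 = Icc 0 1 := uIcc_of_le zero_le_one
  have ia : IntervalIntegrable a volume 0 1 := MonotoneOn.intervalIntegrable (hu ▸ ha)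
  have ia2 : IntervalIntegrable (fun s => a s ^ 2) volume 0 1 := by
    refine MonotoneOn.intervalIntegrable (hu ▸ fun x hx y hy hxy => ?_)
    exact pow_le_pow_left₀ (ha0 x).le (ha hx hy hxy) 2
  have iab := ia.mul_continuousOn hbc.continuousOn
  have iab2 := ia.mul_continuousOn (hbc.pow 2).continuousOn
  have ia2b2 := ia2.mul_continuousOn (hbc.pow 2).continuousOn
  have ib := hbc.intervalIntegrable (μ := volume) 0 1
  have ib2 : IntervalIntegrable (fun s => b s ^ 2) volume 0 1 :=
    (hbc.pow 2).intervalIntegrable 0 1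
  have hB : 0 < ∫ s in (0 : ℝ)..1, b s :=
    intervalIntegral.intervalIntegral_pos_of_pos ib hb0 zero_lt_one
  have hAB : 0 < ∫ s in (0 : ℝ)..1, a s * b s :=
    intervalIntegral.intervalIntegral_pos_of_pos iab (fun s => mul_pos (ha0 s) (hb0 s)) zero_lt_one
  -- The mean of $a$ under the weight $b$, so that $(a-r)b$ integrates to zero.
  set r := (∫ s in (0 : ℝ)..1, a s * b s) / ∫ s in (0 : ℝ)..1, b s with hr
  have hr0 : 0 < r := div_pos hAB hB
  have hrB : (∫ s in (0 : ℝ)..1, a s * b s) = r * ∫ s in (0 : ℝ)..1, b s := by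
    rw [hr, div_mul_cancel₀ _ hB.ne']
  -- By monotonicity $a-r$ changes sign at most once, at a point $p$ where $b-b(p)$ changes sign
  -- too. Adjoining $0$ to `T` covers the case where $a$ is never below $r$.
  obtain ⟨p, hp⟩ : ∃ p : ℝ, ∀ s ∈ Icc (0 : ℝ) 1, 0 ≤ (a s - r) * (b s - b p) := by
    let T : Set ℝ := {s | s ∈ Icc (0 : ℝ) 1 ∧ a s < r} ∪ {0}
    have hT : BddAbove T := ⟨1, by rintro s (⟨hs, _⟩ | rfl) <;> [exact hs.2; exact zero_le_one]⟩
    refine ⟨sSup T, fun s hs => ?_⟩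
    rcases lt_trichotomy s (sSup T) with h | h | h
    · obtain ⟨t, ht, hst⟩ := exists_lt_of_lt_csSup (show T.Nonempty from ⟨0, Or.inr rfl⟩) h
      rcases ht with ⟨ht1, ht2⟩ | rfl
      · exact mul_nonneg_of_nonpos_of_nonpos
          (sub_nonpos.mpr ((ha hs ht1 hst.le).trans ht2.le)) (sub_nonpos.mpr (hb h.le))
      · exact absurd hs.1 (not_le.mpr hst)
    · rw [← h, sub_self, mul_zero]
    · refine mul_nonneg (sub_nonneg.mpr (not_lt.mp fun has => ?_)) (sub_nonneg.mpr (hb h.le))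
      exact absurd (le_csSup hT (Or.inl ⟨hs, has⟩)) (not_le.mpr h)
  have icross : IntervalIntegrable (fun s => (a s - r) * b s) volume 0 1 :=
    (ia.sub intervalIntegrable_const).mul_continuousOn hbc.continuousOn
  have icross2 : IntervalIntegrable (fun s => (a s - r) * b s ^ 2) volume 0 1 :=
    (ia.sub intervalIntegrable_const).mul_continuousOn (hbc.pow 2).continuousOn
  -- Subtracting $b(p)\int(a-r)b=0$ turns the integrand into $(a-r)(b-b(p))b\ge 0$.
  have h1 : 0 ≤ ∫ s in (0 : ℝ)..1, (a s - r) * b s ^ 2 := by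
    have hz : ∫ s in (0 : ℝ)..1, (a s - r) * b s = 0 := by
      simp only [sub_mul]
      rw [intervalIntegral.integral_sub iab (ib.const_mul r), intervalIntegral.integral_const_mul,
        hrB, sub_self]
    have h2 : 0 ≤ ∫ s in (0 : ℝ)..1, ((a s - r) * b s ^ 2 - b p * ((a s - r) * b s)) := by
      refine intervalIntegral.integral_nonneg zero_le_one fun s hs => ?_
      have := mul_nonneg (hp s hs) (hb0 s).le
      linarith
    rwa [intervalIntegral.integral_sub icross2 (icross.const_mul _),
      intervalIntegral.integral_const_mul, hz, mul_zero, sub_zero] at h2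
  have isq : IntervalIntegrable (fun s => (a s - r) ^ 2 * b s ^ 2) volume 0 1 := by
    refine ((ia2b2.sub (iab2.const_mul (2 * r))).add (ib2.const_mul (r ^ 2))).congr fun s _ => ?_
    simp only [Pi.pow_apply]
    ring
  have h2 : 0 < ∫ s in (0 : ℝ)..1, (a s - r) ^ 2 * b s ^ 2 := by
    have hnn : ∀ s, 0 ≤ (a s - r) ^ 2 * b s ^ 2 := fun s => by positivity
    refine lt_of_le_of_ne (intervalIntegral.integral_nonneg zero_le_one fun s _ => hnn s) ?_
    intro h0
    rw [eq_comm, intervalIntegral.integral_eq_zero_iff_of_le_of_nonneg_ae zero_le_one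
      (ae_of_all _ hnn) isq, EventuallyEq, ae_restrict_iff' measurableSet_Ioc] at h0
    refine hne r (h0.mono fun s hs hs1 => ?_)
    have := hs hs1
    simp only [Pi.zero_apply, mul_eq_zero, pow_eq_zero_iff, ne_eq, OfNat.ofNat_ne_zero,
      not_false_eq_true, (hb0 s).ne', or_false] at this
    linarith
  -- Expansion of $a=r+(a-r)$: the cross term is nonnegative, and the square term is positive since
  -- $a$ is not almost everywhere equal to $r$.
  have h3 : ∫ s in (0 : ℝ)..1, (a s * b s) ^ 2 =
      (∫ s in (0 : ℝ)..1, (a s - r) ^ 2 * b s ^ 2) +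
        2 * r * (∫ s in (0 : ℝ)..1, (a s - r) * b s ^ 2) + r ^ 2 * ∫ s in (0 : ℝ)..1, b s ^ 2 := by
    rw [← intervalIntegral.integral_const_mul, ← intervalIntegral.integral_const_mul,
      ← intervalIntegral.integral_add isq (icross2.const_mul _),
      ← intervalIntegral.integral_add (isq.add (icross2.const_mul _)) (ib2.const_mul _)]
    refine intervalIntegral.integral_congr fun s _ => ?_
    ring
  rw [h3, hrB]
  have h4 : 0 < (∫ s in (0 : ℝ)..1, b s) ^ 2 := by positivity
  have h5 : 0 ≤ 2 * r * (∫ s in (0 : ℝ)..1, (a s - r) * b s ^ 2) := by positivity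
  nlinarith [mul_pos h2 h4, mul_nonneg h5 h4.le]

/-- A uniform approximation by rescaled rows forces the boundary values of a nonconstant profile
to be visible on sets of positive measure. -/
theorem not_ae_eq_const_of_rescaledRow {f : ℝ → ℝ} {ν : ℕ → ℕ → ℤ} {D : ℕ → ℝ}
    (hD : ∀ N, ∀ x ∈ Icc (0 : ℝ) 1, |rescaledRow N (ν N) x - f x| ≤ D N)
    (hD0 : Tendsto D atTop (𝓝 0)) (hf01 : f 0 ≠ f 1) (C : ℝ) :
    ¬ ∀ᵐ s : ℝ, s ∈ Ioc (0 : ℝ) 1 → f s = C := by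
  intro hae
  have hε : 0 < |f 0 - f 1| / 4 := by
    have := abs_pos.mpr (sub_ne_zero.mpr hf01)
    positivity
  obtain ⟨N, hN, hDN⟩ :=
    ((eventually_gt_atTop 0).and (hD0.eventually_lt_const hε)).exists
  have hN' : (0 : ℝ) < N := by exact_mod_cast hN
  have hdense := Measure.dense_of_ae hae
  have hN1 : (1 : ℝ) / N ≤ 1 := (div_le_one hN').mpr (by exact_mod_cast hN)
  have hN0 : (0 : ℝ) < 1 / N := by positivity
  have hpred : ((N - 1 : ℕ) : ℝ) / N = 1 - 1 / N := by
    rw [Nat.cast_sub hN]; field_simp; simp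
  -- The rescaled row is constant on $[0,1/N]$, by the convention at $0$, and on the last cell up to
  -- $1$. Points $s,t$ of these cells with $f(s)=f(t)=C$ would give $|f(0)-f(1)|\le 4D_N$, against
  -- the choice of $N$.
  obtain ⟨s, hs, hs1⟩ := hdense.exists_between hN0
  obtain ⟨t, ht, ht1⟩ := hdense.exists_between (show 1 - 1 / (N : ℝ) < 1 by linarith)
  have hs2 : s ∈ Ioc (0 : ℝ) 1 := ⟨hs1.1, hs1.2.le.trans hN1⟩
  have ht2 : t ∈ Ioc (0 : ℝ) 1 := ⟨by linarith [ht1.1], ht1.2.le⟩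
  have e0 : rescaledRow N (ν N) 0 = ν N 1 / N := by simp [rescaledRow]
  have es : rescaledRow N (ν N) s = ν N 1 / N :=
    rescaledRow_of_mem_Ioc hN (ν N) (k := 0) (by simpa using ⟨hs1.1, by simpa using hs1.2.le⟩)
  have ht3 : ((N - 1 + 1 : ℕ) : ℝ) / N = 1 := by
    rw [Nat.sub_add_cancel hN, div_self hN'.ne']
  have e1 : rescaledRow N (ν N) 1 = ν N (N - 1 + 1) / N :=
    rescaledRow_of_mem_Ioc hN (ν N) (by rw [hpred, ht3]; exact ⟨by linarith, le_rfl⟩)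
  have et : rescaledRow N (ν N) t = ν N (N - 1 + 1) / N :=
    rescaledRow_of_mem_Ioc hN (ν N) (by rw [hpred, ht3]; exact ⟨ht1.1, ht1.2.le⟩)
  have d0 := hD N 0 ⟨le_rfl, zero_le_one⟩
  have ds := hD N s ⟨hs2.1.le, hs2.2⟩
  have d1 := hD N 1 ⟨zero_le_one, le_rfl⟩
  have dt := hD N t ⟨ht2.1.le, ht2.2⟩
  have hst : f s = f t := (hs hs2).trans (ht ht2).symm
  rw [e0] at d0
  rw [es] at ds
  rw [e1] at d1
  rw [et, ← hst] at dt
  have : |f 0 - f 1| ≤ 4 * D N := by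
    rw [abs_le] at *
    constructor <;> linarith [d0.1, d0.2, d1.1, d1.2, ds.1, ds.2, dt.1, dt.2]
  linarith

theorem integral_exp_mul_sub_zero_pos {f : ℝ → ℝ} (hf : AntitoneOn f (Icc 0 1)) {α : ℝ}
    (hα : 0 ≤ α) : 0 < ∫ s in (0 : ℝ)..1, Real.exp (α * (s - f s)) :=
  intervalIntegral.intervalIntegral_pos_of_pos (intervalIntegrable_exp_mul_sub hf hα)
    (fun _ => Real.exp_pos _) zero_lt_one

/-- Rewrites $\sigma^2$ as the difference of two variances from the central limit theorem, for $f$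
and for the zero profile. With $m,m_0$ the integrals of $e^{\gamma(s-f)}$ and $e^{\gamma s}$, it
rests on $e^{\gamma u}=m_0/m$ and $e^\gamma-1=\gamma m_0$. -/
theorem limitVariance_eq {γ : ℝ} (hγ : 0 < γ) {f : ℝ → ℝ} (hf : AntitoneOn f (Icc 0 1)) :
    limitVariance γ f =
      ((∫ s in (0 : ℝ)..1, Real.exp (2 * γ * (s - f s))) /
          (∫ s in (0 : ℝ)..1, Real.exp (γ * (s - f s))) ^ 2 -
        (∫ s in (0 : ℝ)..1, Real.exp (2 * γ * (s - 0))) /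
          (∫ s in (0 : ℝ)..1, Real.exp (γ * (s - 0))) ^ 2) / γ ^ 2 := by
  have hm := integral_exp_mul_sub_zero_pos hf hγ.le
  have hzero : AntitoneOn (fun _ : ℝ => (0 : ℝ)) (Icc 0 1) := antitoneOn_const
  have hm0 := integral_exp_mul_sub_zero_pos hzero hγ.le
  have hm0' : ∫ s in (0 : ℝ)..1, Real.exp (γ * (s - 0)) = (Real.exp γ - 1) / γ := by
    simp only [sub_zero]
    rw [intervalIntegral.integral_comp_mul_left (fun s => Real.exp s) hγ.ne', integral_exp]
    simp
    field_simp
  set m := ∫ s in (0 : ℝ)..1, Real.exp (γ * (s - f s)) with hmdef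
  set m0 := ∫ s in (0 : ℝ)..1, Real.exp (γ * (s - 0)) with hm0def
  have hu : Real.exp (2 * γ * globalLocation γ f) = (m0 / m) ^ 2 := by
    have h0 : ∫ s in (0 : ℝ)..1, Real.exp (γ * s) = m0 := by rw [hm0def]; simp
    have : 2 * γ * globalLocation γ f = Real.log (m0 / m) + Real.log (m0 / m) := by
      rw [globalLocation, h0, ← hmdef]
      field_simp
      ring
    rw [this, Real.exp_add, Real.exp_log (div_pos hm0 hm), sq]
  have hsplit : ∫ s in (0 : ℝ)..1,
      (Real.exp (2 * γ * (globalLocation γ f + s - f s)) - Real.exp (2 * s * γ)) =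
      (m0 / m) ^ 2 * (∫ s in (0 : ℝ)..1, Real.exp (2 * γ * (s - f s))) -
        ∫ s in (0 : ℝ)..1, Real.exp (2 * γ * (s - 0)) := by
    rw [← hu, ← intervalIntegral.integral_const_mul, ← intervalIntegral.integral_sub
      ((intervalIntegrable_exp_mul_sub hf (by positivity)).const_mul _)
      (intervalIntegrable_exp_mul_sub hzero (by positivity))]
    refine intervalIntegral.integral_congr fun s _ => ?_
    rw [← Real.exp_add]
    ring_nf
  have hE : Real.exp γ - 1 = m0 * γ := by rw [hm0']; field_simp
  rw [limitVariance, hsplit, hE]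
  field_simp

/-- The correlation inequality with $a=e^{-\gamma f}$ and $b=e^{\gamma s}$, both nondecreasing. -/
theorem limitVariance_pos {γ : ℝ} (hγ : 0 < γ) {f : ℝ → ℝ} (hf : AntitoneOn f (Icc 0 1))
    (hne : ∀ C, ¬ ∀ᵐ s : ℝ, s ∈ Ioc (0 : ℝ) 1 → f s = C) : 0 < limitVariance γ f := by
  have hm := integral_exp_mul_sub_zero_pos hf hγ.le
  have hm0 := integral_exp_mul_sub_zero_pos (f := fun _ => 0) antitoneOn_const hγ.le
  have h := integral_sq_mul_sq_integral_lt (a := fun s => Real.exp (-(γ * f s)))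
    (b := fun s => Real.exp (γ * (s - 0)))
    (fun x hx y hy hxy => Real.exp_le_exp.mpr
      (neg_le_neg (mul_le_mul_of_nonneg_left (hf hx hy hxy) hγ.le)))
    (fun _ => Real.exp_pos _)
    (fun x y hxy => Real.exp_le_exp.mpr (mul_le_mul_of_nonneg_left (by linarith) hγ.le))
    (by fun_prop) (fun _ => Real.exp_pos _)
    (fun C hC => hne (-(Real.log C / γ)) (hC.mono fun s hs hs1 => by
      have := congrArg Real.log (hs hs1)
      rw [Real.log_exp] at this
      rw [← this]
      field_simp))
  have e1 : ∀ s, Real.exp (γ * (s - 0)) ^ 2 = Real.exp (2 * γ * (s - 0)) := fun s => by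
    rw [← Real.exp_nat_mul]; push_cast; ring_nf
  have e2 : ∀ s, Real.exp (-(γ * f s)) * Real.exp (γ * (s - 0)) = Real.exp (γ * (s - f s)) :=
    fun s => by rw [← Real.exp_add]; ring_nf
  have e3 : ∀ s, Real.exp (γ * (s - f s)) ^ 2 = Real.exp (2 * γ * (s - f s)) := fun s => by
    rw [← Real.exp_nat_mul]; push_cast; ring_nf
  simp only [e1, e2, e3] at h
  rw [limitVariance_eq hγ hf]
  refine div_pos (sub_pos.mpr ?_) (by positivity)
  rw [div_lt_div_iff₀ (by positivity) (by positivity)]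
  exact h

/-! ### Normalization and convergence in distribution -/

namespace InterlacingArray

theorem integral_cexp_log_scale {n : ℕ} (hn : 0 < n) {c : Fin n → ℝ} (hc : ∀ j, 0 < c j)
    {a b : ℝ} (ha : 0 < a) (hb : 0 < b) (η : ℝ) :
    ∫ e, Complex.exp (Complex.I * (η * Real.log (a * weightedSum c e) : ℝ)) ∂(expPi n) =
      Complex.exp (Complex.I * (η * (Real.log a - Real.log b) : ℝ)) *
        ∫ e, Complex.exp (Complex.I * (η * Real.log (b * weightedSum c e) : ℝ)) ∂(expPi n) := by
  rw [← integral_const_mul]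
  refine integral_congr_ae ?_
  filter_upwards [ae_weightedSum_pos hn hc] with e he
  rw [← Complex.exp_add, Real.log_mul ha.ne' he.ne', Real.log_mul hb.ne' he.ne']
  congr 1
  push_cast
  ring

theorem expWeight_eq_rowPoint (γ : ℝ) (n : ℕ) (ν : ℕ → ℤ) (j : Fin (n + 1)) :
    expWeight γ (n + 1) ν j =
      Real.exp γ * rowPoint (Real.exp (-γ / (n + 1 : ℕ))) n ν j := by
  have hn : ((n : ℝ) + 1) ≠ 0 := by positivity
  rw [expWeight, rowPoint, ← Real.rpow_intCast, ← Real.exp_mul, ← Real.exp_add, strictRow]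
  congr 1
  push_cast
  field_simp
  ring

theorem expWeight_pos (γ : ℝ) (N : ℕ) (ν : ℕ → ℤ) (j : Fin N) : 0 < expWeight γ N ν j :=
  Real.exp_pos _

/-- The characteristic function of the rescaled first-level entry is a quotient of oscillating
integrals of sums of exponentials. -/
theorem integral_cexp_entry_mul {γ : ℝ} (hγ : 0 < γ) {f : ℝ → ℝ} (hf : AntitoneOn f (Icc 0 1))
    {N : ℕ} (hN : 0 < N) (ν : ℕ → ℤ) (hν : AntitoneOn ν (Set.Icc 1 N)) (ξ : ℝ) :
    (∫ L : InterlacingArray N ν, Complex.exp (ξ *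
          (((L.entry 1 1 : ℝ) - N * globalLocation γ f) / √N : ℝ) * Complex.I)
        ∂(qVol N ν hν (Real.exp (-γ / N)) (Real.exp_pos _)).toMeasure) *
      ∫ e, Complex.exp (Complex.I * (-(ξ / γ) * √N *
        Real.log ((N * ∫ s in (0 : ℝ)..1, Real.exp (γ * (s - 0)))⁻¹ *
          weightedSum (expWeight γ N fun _ => 0) e) : ℝ)) ∂(expPi N) =
      ∫ e, Complex.exp (Complex.I * (-(ξ / γ) * √N *
        Real.log ((N * ∫ s in (0 : ℝ)..1, Real.exp (γ * (s - f s)))⁻¹ *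
          weightedSum (expWeight γ N ν) e) : ℝ)) ∂(expPi N) := by
  obtain ⟨n, rfl⟩ : ∃ n, N = n + 1 := ⟨N - 1, by omega⟩
  have hN' : (0 : ℝ) < (n + 1 : ℕ) := by positivity
  have hs : 0 < √((n + 1 : ℕ) : ℝ) := Real.sqrt_pos.mpr hN'
  have hm := integral_exp_mul_sub_zero_pos hf hγ.le
  have hm0 := integral_exp_mul_sub_zero_pos (f := fun _ => 0) antitoneOn_const hγ.le
  have hu : γ * globalLocation γ f = Real.log (∫ s in (0 : ℝ)..1, Real.exp (γ * (s - 0))) -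
      Real.log (∫ s in (0 : ℝ)..1, Real.exp (γ * (s - f s))) := by
    rw [globalLocation, ← Real.log_div hm0.ne' hm.ne']
    simp only [sub_zero]
    field_simp
  set m := ∫ s in (0 : ℝ)..1, Real.exp (γ * (s - f s))
  set m0 := ∫ s in (0 : ℝ)..1, Real.exp (γ * (s - 0))
  set q := Real.exp (-γ / (n + 1 : ℕ)) with hq
  -- Since $\log q=-\gamma/N$, this frequency makes $\eta\lambda^1_1\log q=\xi\lambda^1_1/\sqrt N$.
  set η := -(ξ / γ) * √((n + 1 : ℕ) : ℝ) with hη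
  have hq1 : q ≠ 1 := by
    rw [hq, Ne, Real.exp_eq_one_iff, div_eq_zero_iff]
    exact fun h => h.elim (fun h' => by linarith) hN'.ne'
  -- The factor $e^\gamma=q^{-N}$ turns the row points into the weights `expWeight`.
  have key := integral_cexp_mul_integral_cexp (q := q) (Real.exp_pos _) hq1 n ν hν η (Real.exp γ)
    (Real.exp_pos γ)
  have hw : ∀ ν : ℕ → ℤ, ∀ e, Real.exp γ * weightedSum (rowPoint q n ν) e =
      1 * weightedSum (expWeight γ (n + 1) ν) e := by
    intro ν e
    rw [one_mul, ← weightedSum_smul]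
    congr 1
    ext j
    exact (expWeight_eq_rowPoint γ n ν j).symm
  simp only [hw] at key
  rw [integral_cexp_log_scale hN (expWeight_pos γ _ _) one_pos
      (show 0 < ((n + 1 : ℕ) * m0)⁻¹ by positivity),
    integral_cexp_log_scale hN (expWeight_pos γ _ _) one_pos
      (show 0 < ((n + 1 : ℕ) * m)⁻¹ by positivity)] at key
  refine mul_left_cancel₀ (Complex.exp_ne_zero (Complex.I *
    (η * (Real.log 1 - Real.log ((n + 1 : ℕ) * m)⁻¹) : ℝ))) ?_
  rw [← key, ← mul_assoc, ← mul_assoc]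
  congr 1
  rw [← integral_const_mul, ← integral_mul_const]
  congr 1
  ext L
  rw [← Complex.exp_add, ← Complex.exp_add]
  congr 1
  have hlogq : Real.log q = -γ / (n + 1 : ℕ) := Real.log_exp _
  -- The phases from normalizing by $Nm$ and $Nm_0$ differ by $\eta(\log m-\log m_0)=-\eta\gamma u$,
  -- which is the centering by $uN$.
  have hreal : η * (Real.log 1 - Real.log ((n + 1 : ℕ) * m)⁻¹) +
      ξ * (((L.entry 1 1 : ℝ) - (n + 1 : ℕ) * globalLocation γ f) / √((n + 1 : ℕ) : ℝ)) =
      η * (Real.log q * L.entry 1 1) + η * (Real.log 1 - Real.log ((n + 1 : ℕ) * m0)⁻¹) := by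
    have hs2 : ((n + 1 : ℕ) : ℝ) = √((n + 1 : ℕ) : ℝ) ^ 2 := (Real.sq_sqrt hN'.le).symm
    rw [Real.log_inv, Real.log_inv, Real.log_mul hN'.ne' hm.ne', Real.log_mul hN'.ne' hm0.ne',
      hlogq]
    have hu' : Real.log m = Real.log m0 - γ * globalLocation γ f := by linarith
    rw [hu', hη]
    generalize √((n + 1 : ℕ) : ℝ) = r at *
    rw [hs2]
    field_simp
    ring
  have hc := congrArg (fun x : ℝ => (x : ℂ) * Complex.I) hreal
  push_cast at hc ⊢
  linear_combination hc

end InterlacingArray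

theorem tendsto_integral_cexp_log_expWeight {γ : ℝ} (hγ : 0 < γ) {f : ℝ → ℝ}
    (hf : AntitoneOn f (Icc 0 1)) {ν : ℕ → ℕ → ℤ} {D : ℕ → ℝ}
    (hD : ∀ N, ∀ x ∈ Icc (0 : ℝ) 1, |rescaledRow N (ν N) x - f x| ≤ D N)
    (hD0 : Tendsto (fun N : ℕ => √N * D N) atTop (𝓝 0)) (hD1 : ∀ᶠ N in atTop, D N ≤ 1) (κ : ℝ) :
    Tendsto (fun N : ℕ => ∫ e, Complex.exp (Complex.I * (κ * √N *
        Real.log ((N * ∫ s in (0 : ℝ)..1, Real.exp (γ * (s - f s)))⁻¹ *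
          weightedSum (expWeight γ N (ν N)) e) : ℝ)) ∂(expPi N)) atTop
      (𝓝 (Complex.exp (-(κ ^ 2 * ((∫ s in (0 : ℝ)..1, Real.exp (2 * γ * (s - f s))) /
        (∫ s in (0 : ℝ)..1, Real.exp (γ * (s - f s))) ^ 2) / 2) : ℝ))) := by
  refine tendsto_integral_cexp_log_weightedSum (fun N => expWeight γ N (ν N))
    (B := Real.exp (γ * (2 + max |f 0| |f 1|))) (integral_exp_mul_sub_zero_pos hf hγ.le) ?_
    (tendsto_sqrt_mul_sum_expWeight hf hγ.le hD hD0 hD1) ?_ κ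
  · filter_upwards [hD1] with N hN j
    rw [abs_of_pos (InterlacingArray.expWeight_pos γ N (ν N) j)]
    exact Real.exp_le_exp.mpr (expWeight_le hf hγ.le (hD N) hN j)
  -- Squared weights are weights with $2\gamma$ in place of $\gamma$, so the same Riemann sum
  -- estimate gives the second moment.
  · have h : ∀ N (j : Fin N), expWeight γ N (ν N) j ^ 2 = expWeight (2 * γ) N (ν N) j := by
      intro N j
      rw [expWeight, expWeight, ← Real.exp_nat_mul]
      congr 1
      push_cast
      ring
    simp only [h]
    exact tendsto_of_tendsto_sqrt_mul_sub
      (tendsto_sqrt_mul_sum_expWeight hf (by positivity) hD hD0 hD1)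

theorem mainTheorem3 (γ : ℝ) (hγ : 0 < γ)
    (f : ℝ → ℝ) (hf_anti : AntitoneOn f (Set.Icc 0 1))
    (hf_nonconst : ∃ x ∈ Set.Icc (0 : ℝ) 1, ∃ y ∈ Set.Icc (0 : ℝ) 1, f x ≠ f y)
    (hf_cont : PiecewiseContinuousOn f 0 1)
    (ν : ℕ → ℕ → ℤ) (hν : ∀ N, AntitoneOn (ν N) (Set.Icc 1 N))
    (hconv : (fun N : ℕ => ⨆ x : Set.Icc (0 : ℝ) 1, |rescaledRow N (ν N) x - f x|)
      =o[atTop] fun N : ℕ => (N : ℝ) ^ (-(1 / 2) : ℝ)) :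
    0 < limitVariance γ f ∧
    TendstoInDistribution
      (fun (N : ℕ) (L : InterlacingArray N (ν N)) =>
        ((L.entry 1 1 : ℝ) - N * globalLocation γ f) / Real.sqrt N)
      atTop (id : ℝ → ℝ)
      (fun N : ℕ =>
        (InterlacingArray.qVol N (ν N) (hν N) (Real.exp (-γ / N)) (Real.exp_pos _)).toMeasure)
      (gaussianReal 0 (limitVariance γ f).toNNReal) := by
  set D : ℕ → ℝ := fun N => ⨆ x : Set.Icc (0 : ℝ) 1, |rescaledRow N (ν N) x - f x| with hDdef
  have hD : ∀ N, ∀ x ∈ Set.Icc (0 : ℝ) 1, |rescaledRow N (ν N) x - f x| ≤ D N :=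
    fun N x hx => abs_rescaledRow_sub_le_iSup hf_anti N (ν N) hx
  have hD0 : Tendsto (fun N : ℕ => √N * D N) atTop (𝓝 0) := by
    refine hconv.tendsto_div_nhds_zero.congr' (Eventually.of_forall fun N => ?_)
    rw [Real.rpow_neg (Nat.cast_nonneg N), ← Real.sqrt_eq_rpow, div_inv_eq_mul, mul_comm]
  have hDlim : Tendsto D atTop (𝓝 0) :=
    tendsto_of_tendsto_sqrt_mul_sub (by simpa using hD0)
  have hD1 : ∀ᶠ N in atTop, D N ≤ 1 := hDlim.eventually_le_const zero_lt_one
  have hf01 : f 0 ≠ f 1 := by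
    intro h
    obtain ⟨x, hx, y, hy, hxy⟩ := hf_nonconst
    have hc : ∀ z ∈ Set.Icc (0 : ℝ) 1, f z = f 0 := fun z hz =>
      le_antisymm (hf_anti (left_mem_Icc.mpr zero_le_one) hz hz.1)
        (h.trans_le (hf_anti hz (right_mem_Icc.mpr zero_le_one) hz.2))
    exact hxy ((hc x hx).trans (hc y hy).symm)
  have hvar : 0 < limitVariance γ f :=
    limitVariance_pos hγ hf_anti fun C => not_ae_eq_const_of_rescaledRow hD hDlim hf01 C
  refine ⟨hvar, fun N => Measurable.of_discrete.aemeasurable, aemeasurable_id, ?_⟩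
  refine ProbabilityMeasure.tendsto_iff_tendsto_charFun.mpr fun ξ => ?_
  simp only [ProbabilityMeasure.coe_mk, Measure.map_id, charFun_gaussianReal]
  have hA := tendsto_integral_cexp_log_expWeight hγ hf_anti hD hD0 hD1 (-(ξ / γ))
  -- The reference sum is the case of zero profile and zero rows, with no approximation error.
  have hA0 := tendsto_integral_cexp_log_expWeight hγ (f := fun _ => 0) (ν := fun _ _ => 0)
    (D := fun _ => 0) antitoneOn_const (by simp [rescaledRow]) (by simp) (by simp) (-(ξ / γ))
  have hquot := hA.div hA0 (Complex.exp_ne_zero _)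
  have hlim : Complex.exp (ξ * ((0 : ℝ) : ℂ) * Complex.I -
      ((limitVariance γ f).toNNReal : ℝ) * ξ ^ 2 / 2) =
      Complex.exp (-((-(ξ / γ)) ^ 2 * ((∫ s in (0 : ℝ)..1, Real.exp (2 * γ * (s - f s))) /
        (∫ s in (0 : ℝ)..1, Real.exp (γ * (s - f s))) ^ 2) / 2) : ℝ) /
      Complex.exp (-((-(ξ / γ)) ^ 2 * ((∫ s in (0 : ℝ)..1, Real.exp (2 * γ * (s - 0))) /
        (∫ s in (0 : ℝ)..1, Real.exp (γ * (s - 0))) ^ 2) / 2) : ℝ) := by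
    rw [← Complex.exp_sub, Real.coe_toNNReal _ hvar.le, limitVariance_eq hγ hf_anti]
    congr 1
    rw [← Complex.ofReal_sub, Complex.ofReal_zero, mul_zero, zero_mul, zero_sub]
    norm_cast
    field_simp
    ring
  rw [hlim]
  simp only [charFun_apply_real]
  refine hquot.congr' ?_
  -- The denominator tends to a nonzero Gaussian value, so it is eventually nonzero and division is
  -- legitimate.
  filter_upwards [eventually_gt_atTop 0, hA0.eventually_ne (Complex.exp_ne_zero _)] with N hN hne
  rw [Pi.div_apply, div_eq_iff hne, ← InterlacingArray.integral_cexp_entry_mul hγ hf_anti hN (ν N) (hν N) ξ]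
  congr 1
  rw [integral_map Measurable.of_discrete.aemeasurable
    (Measurable.aestronglyMeasurable (by fun_prop))]
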